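/- **Conventions.** A function $\nu:\mathbb N\to\mathbb R$ is negligible if $\lambda^c\nu(\lambda)\to 0$ for every $c\in\mathbb N$. PPT (QPT) means a family, indexed by the security parameter $\lambda$, of randomized classical (respectively quantum) circuits of size polynomial in $\lambda$. In a protocol the two parties exchange classical messages for polynomially many rounds. Quantum circuits consist of the gates $H$, $T$, CNOT, classically controlled $X$, computational-basis measurements, and randomized classical gates on classical bits. **Oblivious state preparation (OSP).** An OSP is a protocol $(s,|\psi\rangle)\leftarrow\langle S(1^\lambda,r),R(1^\lambda)\rangle$ between a PPT sender $S$ with input $r\in\{0,1\}$ and output $s\in\{0,1\}$, and a QPT receiver $R$ that outputs a qubit (a designated qubit of its final register, whose pure state given the run is $|\psi\rangle$), such that: * *Correctness.* For each $r\in\{0,1\}$, with $\Pi_r=\sum_{s}|s\rangle\langle s|\otimes H^r|s\rangle\langle s|H^r$ (the second factor acting on the output qubit), $$\mathbb E\big[\|\Pi_r|s\rangle|\psi\rangle\|:(s,|\psi\rangle)\leftarrow\langle S(1^\lambda,r),R(1^\lambda)\rangle\big]=1-\mathrm{negl}(\lambda).$$ * *Security.* For every QPT adversary $\{A_\lambda\}$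 playing the receiver and outputting a bit, $$\big|\Pr[A_\lambda\text{ outputs }0\mid r=0]-\Pr[A_\lambda\text{ outputs }0\mid r=1]\big|=\mathrm{negl}(\lambda).$$ **Proof of quantumness.** A proof of quantumness with completeness $\epsilon(\lambda)$ and soundness $\delta(\lambda)$, where $\epsilon-\delta\ge 1/\mathrm{poly}(\lambda)$ for all large $\lambda$, is a protocol between a QPT prover $P$ and a PPT verifier $V$ such that $V$ accepts $P$ with probability at least $\epsilon(\lambda)$ for every $\lambda$, and for every PPT (classical) prover $\{A_\lambda\}$ the verifier accepts $A_\lambda$ with probability at most $\delta(\lambda)+\mathrm{negl}(\lambda)$. **Computational CHSH test of an OSP.** The verifier samples a uniform $r\in\{0,1\}$ and runs the OSP with the prover as the sender with input $r$, obtaining $s$; it then sends a uniform $a\in\{0,1\}$ to the prover, receives a bit $b$, and accepts iff $b=s\oplus r\cdot a$. The honest prover acts as the receiver in the OSP, and then measures its output qubit in the basis $\{\cos\theta|0\rangle+\sin\theta|1\rangle,\,-\sin\theta|0\rangle+\cos\theta|1\rangle\}$ with $\theta=\pi/8$ if $a=0$ and $\theta=-\pi/8$ if $a=1$, and answers with the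 outcome $b$. **Theorem.** For every OSP, its computational CHSH test is a proof of quantumness. More precisely, there is a negligible function $\nu$ such that the test is a proof of quantumness with completeness $\epsilon(\lambda)=\cos^2(\pi/8)-\nu(\lambda)$, which exceeds $0.85$ for all large $\lambda$, and soundness $\delta=3/4$: the honest quantum prover is accepted with probability at least $\cos^2(\pi/8)-\nu(\lambda)$, and every PPT prover is accepted with probability at most $3/4+\mathrm{negl}(\lambda)$. -/

import Mathlib

open Filter

noncomputable section

namespace OSPQuantum

/-! ## Asymptotics -/

/-- Negligible functions of the security parameter: `n ^ c * f n → 0` for every `c`. -/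
def Negligible (f : ℕ → ℝ) : Prop :=
  Asymptotics.SuperpolynomialDecay atTop (fun n : ℕ => (n : ℝ)) f

/-- `f` is bounded by a polynomial for all large arguments. -/
def PolyBounded (f : ℕ → ℕ) : Prop :=
  ∃ c N : ℕ, ∀ n > N, f n < n ^ c

/-! ## Randomized classical circuits -/

/-- Gates of randomized Boolean circuits on the bit wires `W`. -/
inductive CGate (W : Type) : Type
  /-- overwrite wire `k` with `f` of the values on the wires `i` and `j` -/
  | app (f : Bool → Bool → Bool) (i j k : W)
  /-- overwrite wire `k` with a fresh uniformly random bit -/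
  | coin (k : W)

/-- Move a gate to other wires. -/
def CGate.map {W W' : Type} (e : W → W') : CGate W → CGate W'
  | .app f i j k => .app f (e i) (e j) (e k)
  | .coin k => .coin (e k)

/-- The gate that copies the bit on wire `i` to wire `k`. -/
def CGate.copy {W : Type} (i k : W) : CGate W := .app (fun x _ => x) i i k

/-- The effect of a gate on the contents of the wires. -/
def CGate.run {W : Type} [DecidableEq W] : CGate W → (W → Bool) → PMF (W → Bool)
  | .app f i j k, w => PMF.pure (Function.update w k (f (w i) (w j)))
  | .coin k, w => do
      let b ← PMF.uniformOfFintype Bool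
      PMF.pure (Function.update w k b)

/-- Run a randomized classical circuit, a list of gates. -/
def runC {W : Type} [DecidableEq W] : List (CGate W) → (W → Bool) → PMF (W → Bool)
  | [], w => PMF.pure w
  | g :: gs, w => do
      let w' ← g.run w
      runC gs w'

/-! ## Pure states of a register of qubits -/

section States

variable {Q : Type} [Fintype Q] [DecidableEq Q]

/-- Vectors of the Hilbert space of the qubits `Q`, in coordinates for the computational basis. -/
abbrev QVec (Q : Type) : Type := EuclideanSpace ℂ (Q → Bool)

/-- Pure states: unit vectors. -/
def QState (Q : Type) [Fintype Q] [DecidableEq Q] : Type := {ψ : QVec Q // ‖ψ‖ = 1}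

/-- Flip bit `t` of a basis label. -/
def flipBit (t : Q) (x : Q → Bool) : Q → Bool := Function.update x t (!x t)

theorem flipBit_invol {Q : Type} [DecidableEq Q] (t : Q) : Function.Involutive (flipBit t) := by
  intro x
  simp [flipBit]

/-- The Pauli gate `X` on qubit `t`. -/
def xV (t : Q) (ψ : QVec Q) : QVec Q :=
  WithLp.toLp 2 fun x => ψ (flipBit t x)

/-- The Hadamard gate on qubit `t`. -/
def hadV (t : Q) (ψ : QVec Q) : QVec Q :=
  WithLp.toLp 2 fun x => ((1 / Real.sqrt 2 : ℝ) : ℂ) *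
    (ψ (Function.update x t false) +
      (if x t then -1 else 1) * ψ (Function.update x t true))

/-- The gate `T = diag(1, exp (i π / 4))` on qubit `t`. -/
def tV (t : Q) (ψ : QVec Q) : QVec Q :=
  WithLp.toLp 2 fun x => (if x t then Complex.exp (Real.pi / 4 * Complex.I) else 1) * ψ x

/-- The controlled-NOT gate with control `c` and target `t`. -/
def cnotV (c t : Q) (ψ : QVec Q) : QVec Q :=
  WithLp.toLp 2 fun x => ψ (if x c then flipBit t x else x)

/-- The projector `|b⟩⟨b|` on qubit `t` (tensored with the identity on the other qubits). -/
def projV (t : Q) (b : Bool) (ψ : QVec Q) : QVec Q :=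
  WithLp.toLp 2 fun x => if x t = b then ψ x else 0

theorem norm_eq_of_sum {ψ φ : QVec Q} (h : ∑ x, ‖ψ x‖ ^ 2 = ∑ x, ‖φ x‖ ^ 2) : ‖ψ‖ = ‖φ‖ := by
  rw [EuclideanSpace.norm_eq, EuclideanSpace.norm_eq, h]

theorem norm_xV (t : Q) (ψ : QVec Q) : ‖xV t ψ‖ = ‖ψ‖ :=
  norm_eq_of_sum (Equiv.sum_comp (flipBit_invol t).toPerm fun x => ‖ψ x‖ ^ 2)

theorem norm_tV (t : Q) (ψ : QVec Q) : ‖tV t ψ‖ = ‖ψ‖ := by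
  apply norm_eq_of_sum
  refine Finset.sum_congr rfl fun x _ => ?_
  have h : ‖Complex.exp (Real.pi / 4 * Complex.I)‖ = 1 := by
    have := Complex.norm_exp_ofReal_mul_I (Real.pi / 4)
    push_cast at this
    exact this
  by_cases hx : x t <;> simp [tV, hx, h]

theorem norm_cnotV {c t : Q} (h : c ≠ t) (ψ : QVec Q) :
    ‖cnotV c t ψ‖ = ‖ψ‖ := by
  have hi : Function.Involutive fun x : Q → Bool => if x c then flipBit t x else x := by
    intro x
    by_cases hx : x c
    · have h' : flipBit t x c = true := by simp [flipBit, h, hx]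
      simp [hx, h', flipBit_invol t x]
    · simp [hx]
  exact norm_eq_of_sum (Equiv.sum_comp hi.toPerm fun x => ‖ψ x‖ ^ 2)

theorem norm_hadV (t : Q) (ψ : QVec Q) : ‖hadV t ψ‖ = ‖ψ‖ := by
  apply norm_eq_of_sum
  have key : ∀ x : Q → Bool, ‖hadV t ψ x‖ ^ 2 + ‖hadV t ψ (flipBit t x)‖ ^ 2
      = ‖ψ x‖ ^ 2 + ‖ψ (flipBit t x)‖ ^ 2 := by
    intro x
    have par := fun u v : ℂ => parallelogram_law_with_norm ℝ u v
    have h2 : (1 / Real.sqrt 2) ^ 2 = 1 / 2 := by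
      rw [div_pow, Real.sq_sqrt (by norm_num)]; norm_num
    have h2' : ‖((1 / Real.sqrt 2 : ℝ) : ℂ)‖ ^ 2 = 1 / 2 := by
      rw [Complex.norm_real, Real.norm_eq_abs, sq_abs, h2]
    have e : ∀ b, x t = b → Function.update x t b = x := by
      intro b hb; rw [← hb, Function.update_eq_self]
    cases hx : x t
    · have e1 := e _ hx
      have := par (ψ x) (ψ (Function.update x t true))
      simp only [hadV, flipBit, hx, e1, norm_mul, mul_pow, h2', Bool.not_false,
        Function.update_self, Function.update_idem, if_true, Bool.false_eq_true, if_false,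
        one_mul, neg_mul, ← sub_eq_add_neg]
      linarith
    · have e1 := e _ hx
      have := par (ψ (Function.update x t false)) (ψ x)
      simp only [hadV, flipBit, hx, e1, norm_mul, mul_pow, h2', Bool.not_true,
        Function.update_self, Function.update_idem, if_true, Bool.false_eq_true, if_false,
        one_mul, neg_mul, ← sub_eq_add_neg]
      linarith
  have hs := Finset.sum_congr (s₁ := Finset.univ) rfl fun x _ => key x
  rw [Finset.sum_add_distrib, Finset.sum_add_distrib] at hs
  have f1 := Equiv.sum_comp (flipBit_invol t).toPerm fun x => ‖hadV t ψ x‖ ^ 2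
  have f2 := Equiv.sum_comp (flipBit_invol t).toPerm fun x => ‖ψ x‖ ^ 2
  simp only [Function.Involutive.coe_toPerm] at f1 f2
  linarith

theorem norm_projV_add (t : Q) (ψ : QVec Q) :
    ‖projV t true ψ‖ ^ 2 + ‖projV t false ψ‖ ^ 2 = ‖ψ‖ ^ 2 := by
  simp only [EuclideanSpace.norm_sq_eq, ← Finset.sum_add_distrib]
  refine Finset.sum_congr rfl fun x _ => ?_
  cases hx : x t <;> simp [projV, hx]

/-- The state `|0…0⟩`. -/
def zeroState : QState Q :=
  ⟨EuclideanSpace.single (fun _ => false) 1, by simp⟩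

/-- Born rule: the outcome of measuring qubit `t` in the computational basis. -/
def measOutcome (t : Q) (ψ : QState Q) : PMF Bool :=
  PMF.ofFintype (fun b => ENNReal.ofReal (‖projV t b ψ.1‖ ^ 2)) (by
    rw [Fintype.sum_bool, ← ENNReal.ofReal_add (by positivity) (by positivity),
      norm_projV_add, ψ.2]
    simp)

/-- The normalized state after outcome `b` (outcomes of probability zero never occur). -/
def collapse (t : Q) (b : Bool) (ψ : QState Q) : QState Q := by
  exact open Classical in if h : projV t b ψ.1 = 0 then ψ
    else ⟨((‖projV t b ψ.1‖ : ℂ)⁻¹) • projV t b ψ.1, by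
      rw [norm_smul, norm_inv, Complex.norm_real, norm_norm,
        inv_mul_cancel₀ (norm_ne_zero_iff.mpr h)]⟩

end States

/-! ## Quantum circuits -/

/-- Gates of quantum circuits on the bit wires `W` and the qubits `Q`: randomized classical
gates on the bits, the universal gate set `H`, `T`, `CNOT` on the qubits, `X` on a qubit
controlled by a bit, and measurement of a qubit in the computational basis. -/
inductive QGate (W Q : Type) : Type
  | classical (g : CGate W)
  | had (t : Q)
  | tgate (t : Q)
  | cnot (c t : Q) (h : c ≠ t)
  /-- apply `X` to qubit `t` if the bit on wire `i` is 1 -/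
  | ctrlX (i : W) (t : Q)
  /-- measure qubit `t` and write the outcome on wire `k` -/
  | meas (t : Q) (k : W)

/-- Move a gate to other bit wires. -/
def QGate.map {W W' Q : Type} (e : W → W') : QGate W Q → QGate W' Q
  | .classical g => .classical (g.map e)
  | .had t => .had t
  | .tgate t => .tgate t
  | .cnot c t h => .cnot c t h
  | .ctrlX i t => .ctrlX (e i) t
  | .meas t k => .meas t (e k)

/-- The effect of a gate on the bits and on the state of the qubits. -/
def QGate.run {W Q : Type} [DecidableEq W] [Fintype Q] [DecidableEq Q] :
    QGate W Q → (W → Bool) × QState Q → PMF ((W → Bool) × QState Q)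
  | .classical g, (w, ψ) => do
      let w' ← g.run w
      PMF.pure (w', ψ)
  | .had t, (w, ψ) => PMF.pure (w, ⟨hadV t ψ.1, by rw [norm_hadV, ψ.2]⟩)
  | .tgate t, (w, ψ) => PMF.pure (w, ⟨tV t ψ.1, by rw [norm_tV, ψ.2]⟩)
  | .cnot c t h, (w, ψ) => PMF.pure (w, ⟨cnotV c t ψ.1, by rw [norm_cnotV h, ψ.2]⟩)
  | .ctrlX i t, (w, ψ) =>
      PMF.pure (w, if w i then ⟨xV t ψ.1, by rw [norm_xV, ψ.2]⟩ else ψ)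
  | .meas t k, (w, ψ) => do
      let b ← measOutcome t ψ
      PMF.pure (Function.update w k b, collapse t b ψ)

/-- Run a quantum circuit, a list of gates. -/
def runQ {W Q : Type} [DecidableEq W] [Fintype Q] [DecidableEq Q] :
    List (QGate W Q) → (W → Bool) × QState Q → PMF ((W → Bool) × QState Q)
  | [], s => PMF.pure s
  | g :: gs, s => do
      let s' ← g.run s
      runQ gs s'

/-! ## Interactive parties

The parties communicate classically: `C` is the set of bits of the message register, which both
parties read and write. In each round the first party runs a circuit on its private memory and the
message register, and then the second party does. -/

/-- A classical interactive party, with private bits `Mem`, which runs `turn i` in round `i`. -/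
structure ClassicalParty (C : Type) where
  Mem : Type
  [fintypeMem : Fintype Mem]
  [decEqMem : DecidableEq Mem]
  turn : ℕ → List (CGate (Mem ⊕ C))

/-- A quantum interactive party, with private bits `Mem` and private qubits `Qub`. -/
structure QuantumParty (C : Type) where
  Mem : Type
  Qub : Type
  [fintypeMem : Fintype Mem]
  [decEqMem : DecidableEq Mem]
  [fintypeQub : Fintype Qub]
  [decEqQub : DecidableEq Qub]
  turn : ℕ → List (QGate (Mem ⊕ C) Qub)

attribute [instance] ClassicalParty.fintypeMem ClassicalParty.decEqMem
  QuantumParty.fintypeMem QuantumParty.decEqMem QuantumParty.fintypeQub QuantumParty.decEqQub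

/-- Number of bits and gates used in `k` rounds. -/
def ClassicalParty.size {C : Type} (P : ClassicalParty C) (k : ℕ) : ℕ :=
  Fintype.card P.Mem + ∑ i ∈ Finset.range k, (P.turn i).length

/-- Number of bits, qubits and gates used in `k` rounds. -/
def QuantumParty.size {C : Type} (P : QuantumParty C) (k : ℕ) : ℕ :=
  Fintype.card P.Mem + Fintype.card P.Qub + ∑ i ∈ Finset.range k, (P.turn i).length

/-- The action of a classical party in round `i`. -/
def ClassicalParty.act {C : Type} [DecidableEq C] (P : ClassicalParty C) (i : ℕ) :
    (P.Mem → Bool) × (C → Bool) → PMF ((P.Mem → Bool) × (C → Bool))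
  | (m, c) => do
      let w ← runC (P.turn i) (Sum.elim m c)
      PMF.pure (w ∘ Sum.inl, w ∘ Sum.inr)

/-- The private states of a quantum party. -/
abbrev QuantumParty.State {C : Type} (P : QuantumParty C) : Type :=
  (P.Mem → Bool) × QState P.Qub

/-- The action of a quantum party in round `i`. -/
def QuantumParty.act {C : Type} [DecidableEq C] (P : QuantumParty C) (i : ℕ) :
    P.State × (C → Bool) → PMF (P.State × (C → Bool))
  | ((m, ψ), c) => do
      let s ← runQ (P.turn i) (Sum.elim m c, ψ)
      PMF.pure ((s.1 ∘ Sum.inl, s.2), s.1 ∘ Sum.inr)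

/-- Initial state of a quantum party: all bits are 0 and all qubits are `|0⟩`. -/
def QuantumParty.init {C : Type} (P : QuantumParty C) : P.State :=
  (fun _ => false, zeroState)

/-- The joint distribution of the two private states and the message register after `k` rounds,
the first party moving first in each round. -/
def interact {α β γ : Type} (actA : ℕ → α × γ → PMF (α × γ)) (actB : ℕ → β × γ → PMF (β × γ))
    (a : α) (c : γ) (b : β) : ℕ → PMF (α × γ × β)
  | 0 => PMF.pure (a, c, b)
  | k + 1 => do
      let s ← interact actA actB a c b k
      let s' ← actA k (s.1, s.2.1)
      let s'' ← actB k (s.2.2, s'.2)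
      PMF.pure (s'.1, s''.2, s''.1)

/-- The probability that a random bit is equal to `b`, as a real number. -/
def prob (p : PMF Bool) (b : Bool) : ℝ := (p b).toReal

/-- The expectation of `f` under `p`. -/
def expect {α : Type} (p : PMF α) (f : α → ℝ) : ℝ := ∑' x, (p x).toReal * f x

/-! ## Oblivious state preparation -/

/-- An OSP sender, with an input bit and an output bit. -/
structure Sender (C : Type) extends ClassicalParty C where
  inp : Mem
  out : Mem

/-- Initial memory of the sender on input `b`. -/
def Sender.init {C : Type} (S : Sender C) (b : Bool) : S.Mem → Bool :=
  Function.update (fun _ => false) S.inp b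

/-- An honest OSP receiver, with an output qubit. -/
structure Receiver (C : Type) extends QuantumParty C where
  outQubit : Qub

/-- A malicious OSP receiver, with an output bit. -/
structure Distinguisher (C : Type) extends QuantumParty C where
  out : Mem

/-- A two-party protocol between a sender and a receiver, for every security parameter. -/
structure OSPProtocol where
  Comm : ℕ → Type
  [fintypeComm : ∀ n, Fintype (Comm n)]
  [decEqComm : ∀ n, DecidableEq (Comm n)]
  rounds : ℕ → ℕ
  sender : ∀ n, Sender (Comm n)
  receiver : ∀ n, Receiver (Comm n)

attribute [instance] OSPProtocol.fintypeComm OSPProtocol.decEqComm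

namespace OSPProtocol

variable (O : OSPProtocol)

/-- Interaction of the sender on input `b` with an arbitrary quantum party. -/
def interaction (n : ℕ) (b : Bool) (R : QuantumParty (O.Comm n)) :
    PMF (((O.sender n).Mem → Bool) × (O.Comm n → Bool) × R.State) :=
  interact (O.sender n).act R.act ((O.sender n).init b) (fun _ => false) R.init (O.rounds n)

/-- The sender runs in probabilistic polynomial time, and the receiver in quantum polynomial
time. -/
def Efficient : Prop :=
  PolyBounded (fun n => Fintype.card (O.Comm n) + O.rounds n) ∧
  PolyBounded (fun n => (O.sender n).size (O.rounds n)) ∧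
  PolyBounded (fun n => (O.receiver n).size (O.rounds n))

/-- `H ^ b` on qubit `t`. -/
def hadPow {Q : Type} [Fintype Q] [DecidableEq Q] (b : Bool) (t : Q) (ψ : QVec Q) : QVec Q :=
  if b then hadV t ψ else ψ

/-- The norm of `Π_b |s⟩|ψ⟩` for `Π_b = ∑ s, |s⟩⟨s| ⊗ H^b |s⟩⟨s| H^b`, the second factor acting
on qubit `t` of `ψ`; it is the norm of `(H^b |s⟩⟨s| H^b) ψ`. -/
def ospNorm {Q : Type} [Fintype Q] [DecidableEq Q] (b s : Bool) (t : Q) (ψ : QVec Q) : ℝ :=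
  ‖hadPow b t (projV t s (hadPow b t ψ))‖

/-- Correctness: for either input `b`, the expectation of `‖Π_b |s⟩|ψ⟩‖` is `1 - negl`. -/
def Correct : Prop :=
  ∀ b : Bool, Negligible fun n =>
    1 - expect (O.interaction n b (O.receiver n).toQuantumParty)
      fun z => ospNorm b (z.1 (O.sender n).out) (O.receiver n).outQubit z.2.2.2.1

/-- The output bit of a malicious receiver when the sender's input is `b`. -/
def guess (n : ℕ) (b : Bool) (A : Distinguisher (O.Comm n)) : PMF Bool :=
  (O.interaction n b A.toQuantumParty).map fun z => z.2.2.1 A.out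

/-- Security: no malicious quantum polynomial-time receiver tells apart the sender's inputs. -/
def Secure : Prop :=
  ∀ A : ∀ n, Distinguisher (O.Comm n),
    PolyBounded (fun n => (A n).size (O.rounds n)) →
    Negligible fun n => |prob (O.guess n false (A n)) false - prob (O.guess n true (A n)) false|

/-- Oblivious state preparation. -/
def IsOSP : Prop := O.Efficient ∧ O.Correct ∧ O.Secure

end OSPProtocol

/-! ## Proofs of quantumness -/

/-- A classical verifier; it accepts if its bit `out` is 1 at the end. -/
structure Verifier (C : Type) extends ClassicalParty C where
  out : Mem

/-- A protocol between a classical verifier and a quantum prover, for every security parameter. -/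
structure PoQProtocol where
  Comm : ℕ → Type
  [fintypeComm : ∀ n, Fintype (Comm n)]
  [decEqComm : ∀ n, DecidableEq (Comm n)]
  rounds : ℕ → ℕ
  verifier : ∀ n, Verifier (Comm n)
  prover : ∀ n, QuantumParty (Comm n)

attribute [instance] PoQProtocol.fintypeComm PoQProtocol.decEqComm

namespace PoQProtocol

variable (P : PoQProtocol)

/-- The verifier runs in probabilistic polynomial time, and the prover in quantum polynomial
time. -/
def Efficient : Prop :=
  PolyBounded (fun n => Fintype.card (P.Comm n) + P.rounds n) ∧
  PolyBounded (fun n => (P.verifier n).size (P.rounds n)) ∧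
  PolyBounded (fun n => (P.prover n).size (P.rounds n))

/-- The probability that the verifier accepts the honest quantum prover. -/
def honestAccept (n : ℕ) : ℝ :=
  prob ((interact (P.verifier n).act (P.prover n).act (fun _ => false) (fun _ => false)
    (P.prover n).init (P.rounds n)).map fun z => z.1 (P.verifier n).out) true

/-- The probability that the verifier accepts a classical prover. -/
def classicalAccept (n : ℕ) (A : ClassicalParty (P.Comm n)) : ℝ :=
  prob ((interact (P.verifier n).act A.act (fun _ => false) (fun _ => false)
    (fun _ => false) (P.rounds n)).map fun z => z.1 (P.verifier n).out) true

/-- Completeness `ε`. -/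
def Complete (ε : ℕ → ℝ) : Prop := ∀ n, ε n ≤ P.honestAccept n

/-- Soundness `δ` against probabilistic polynomial-time provers. -/
def Sound (δ : ℕ → ℝ) : Prop :=
  ∀ A : ∀ n, ClassicalParty (P.Comm n),
    PolyBounded (fun n => (A n).size (P.rounds n)) →
    ∃ ν : ℕ → ℝ, Negligible ν ∧ ∀ n, P.classicalAccept n (A n) ≤ δ n + ν n

/-- Proof of quantumness with completeness `ε` and soundness `δ`, where `ε - δ` is at least
inverse polynomial for large security parameters. -/
def IsProofOfQuantumnessWith (ε δ : ℕ → ℝ) : Prop :=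
  P.Efficient ∧ (∃ c N : ℕ, ∀ n > N, 1 / (n : ℝ) ^ c ≤ ε n - δ n) ∧
    P.Complete ε ∧ P.Sound δ

/-- Proof of quantumness. -/
def IsProofOfQuantumness : Prop := ∃ ε δ : ℕ → ℝ, P.IsProofOfQuantumnessWith ε δ

end PoQProtocol

/-! ## The computational CHSH test -/

/-- The verifier's own bits: the OSP input `r`, the challenge `a`, and the verdict. -/
inductive CHSHBit : Type
  | r | a | verdict
  deriving DecidableEq

instance : Fintype CHSHBit := ⟨{.r, .a, .verdict}, fun x => by cases x <;> simp⟩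

section CHSH

variable {C : Type}

/-- The place of the OSP sender's wires among those of the CHSH verifier. The message register is
that of the OSP together with one more bit, for the challenge and the answer. -/
def senderWire (S : Sender C) : S.Mem ⊕ C → (S.Mem ⊕ CHSHBit) ⊕ (C ⊕ Unit) :=
  Sum.map Sum.inl Sum.inl

/-- The CHSH verifier: sample `r`, run the `k` rounds of the OSP as a sender with input `r`, send
a random challenge `a`, get an answer `b`, and accept if `b = s ⊕ r·a`. -/
def chshVerifier (k : ℕ) (S : Sender C) : Verifier (C ⊕ Unit) where
  Mem := S.Mem ⊕ CHSHBit
  turn i :=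
    (if i = 0 then [.coin (.inl (.inr .r)), .copy (.inl (.inr .r)) (.inl (.inl S.inp))] else []) ++
    (if i < k then (S.turn i).map (CGate.map (senderWire S))
    else if i = k then
      [.coin (.inl (.inr .a)), .copy (.inl (.inr .a)) (.inr (.inr ()))]
    else if i = k + 1 then
      [.app Bool.and (.inl (.inr .r)) (.inl (.inr .a)) (.inl (.inr .verdict)),
        .app Bool.xor (.inl (.inr .verdict)) (.inl (.inl S.out)) (.inl (.inr .verdict)),
        .app (fun x y => x == y) (.inl (.inr .verdict)) (.inr (.inr ())) (.inl (.inr .verdict))]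
    else [])
  out := .inr .verdict

/-- Measure qubit `t` in the basis `X + Z`, that is
`{cos(π/8)|0⟩ + sin(π/8)|1⟩, -sin(π/8)|0⟩ + cos(π/8)|1⟩}`, if the bit on wire `w` is 0, and in the
basis `X - Z`, that is `{cos(π/8)|0⟩ - sin(π/8)|1⟩, sin(π/8)|0⟩ + cos(π/8)|1⟩}`, if it is 1, and
write the outcome on wire `w`. The first three gates apply `Z` if the bit is 1, which maps the
second basis to the first (up to signs), and the next five map the first basis to the
computational one (up to phases). -/
def measureCHSH {W Q : Type} (w : W) (t : Q) : List (QGate W Q) :=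
  [.had t, .ctrlX w t, .had t, .tgate t, .tgate t, .had t, .tgate t, .had t, .meas t w]

/-- The honest prover: run the `k` rounds of the OSP as a receiver, then measure the output qubit
in the basis asked for by the challenge and answer with the outcome. -/
def chshProver (k : ℕ) (R : Receiver C) : QuantumParty (C ⊕ Unit) where
  Mem := R.Mem
  Qub := R.Qub
  turn i :=
    if i < k then (R.turn i).map (QGate.map (Sum.map id Sum.inl))
    else if i = k then measureCHSH (.inr (.inr ())) R.outQubit
    else []

/-- The computational CHSH test built from an OSP protocol. In its last round the verifier
computes its verdict and nothing is sent. -/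
def chshTest (O : OSPProtocol) : PoQProtocol where
  Comm n := O.Comm n ⊕ Unit
  rounds n := O.rounds n + 2
  verifier n := chshVerifier (O.rounds n) (O.sender n)
  prover n := chshProver (O.rounds n) (O.receiver n)

end CHSH

end OSPQuantum

end

open OSPQuantum

namespace OSPQuantum

/-! ## Expectations -/

section Expect

variable {α β : Type}

/-! Both bounds start from `chshVerifier_verdict`. It strips the verifier's bookkeeping and leaves a
uniform `r`, an OSP run of the sender against an arbitrary prover, a uniform `a`, and the test of
the single answer that the prover then gives.

Completeness is CHSH geometry. For fixed `r` and `s`, averaging over `a` the projectors on the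
correct answer gives `1/2 + (2Π - 1)/(2√2)`, where `Π` projects on the state that a correct OSP
would deliver (`sum_norm_projV_chshRot`). If `q` is the norm of the projection by `Π`, the prover
wins with probability `cos²(π/8) - (1 - q²)/√2`, which is at least `cos²(π/8) - 2(1 - q)`. The last
bound is affine in `q`, so it can be averaged over the run, and OSP correctness controls exactly the
expectation of `q`. Averaging over `r` yields the explicit error `∑ r, (1 - E q)` of
`chshTest_honestAccept`.

Soundness is rewinding. The state of a classical prover after the OSP can be copied and run on both
challenges (`runC_rewindCircuit`). Correct answers are `s` and `s ⊕ r`, with sum `r`, so a prover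
that wins with probability `p` for given `r` predicts `r` with probability at least `2p - 1`
(`two_mul_accept_le`). This computation is a circuit without qubits, hence a legitimate malicious
receiver (`simDistinguisher_out`). If `η` is its advantage, its success probabilities for the two
values of `r` sum to at most `1 + η`. This gives acceptance at most `3/4 + η/4`
(`chshTest_classicalAccept`), and OSP security makes `η` negligible.

The rest transports circuits along injections of wires (`runC_map`, `runQ_map`), compares
interactions move by move (`interact_map`), and counts gates. -/

theorem summable_expect (p : PMF α) {f : α → ℝ} {C : ℝ} (hf : ∀ x, |f x| ≤ C) :
    Summable fun x => (p x).toReal * f x := by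
  have hp : Summable fun x => (p x).toReal :=
    ENNReal.summable_toReal (by rw [p.tsum_coe]; exact ENNReal.one_ne_top)
  refine Summable.of_norm_bounded (hp.mul_right C) fun x => ?_
  rw [norm_mul, Real.norm_eq_abs, Real.norm_eq_abs, abs_of_nonneg ENNReal.toReal_nonneg]
  exact mul_le_mul_of_nonneg_left (hf x) ENNReal.toReal_nonneg

theorem expect_const (p : PMF α) (c : ℝ) : expect p (fun _ => c) = c := by
  unfold expect
  rw [tsum_mul_right, ← ENNReal.tsum_toReal_eq fun x => p.apply_ne_top x, p.tsum_coe]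
  simp

/-- The bounds on `f` and `g` guarantee summability: `expect` is a `tsum` over a possibly infinite
type, which would silently be zero otherwise. -/
theorem expect_mono (p : PMF α) {f g : α → ℝ} {C D : ℝ} (hf : ∀ x, |f x| ≤ C)
    (hg : ∀ x, |g x| ≤ D) (h : ∀ x, f x ≤ g x) : expect p f ≤ expect p g :=
  (summable_expect p hf).tsum_le_tsum
    (fun x => mul_le_mul_of_nonneg_left (h x) ENNReal.toReal_nonneg) (summable_expect p hg)

theorem expect_add (p : PMF α) {f g : α → ℝ} {C D : ℝ} (hf : ∀ x, |f x| ≤ C)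
    (hg : ∀ x, |g x| ≤ D) : expect p (fun x => f x + g x) = expect p f + expect p g := by
  unfold expect
  rw [← (summable_expect p hf).tsum_add (summable_expect p hg)]
  simp only [mul_add]

theorem expect_const_mul (p : PMF α) (c : ℝ) (f : α → ℝ) :
    expect p (fun x => c * f x) = c * expect p f := by
  unfold expect
  rw [← tsum_mul_left]
  exact tsum_congr fun x => by ring

theorem prob_nonneg (p : PMF Bool) (b : Bool) : 0 ≤ prob p b := ENNReal.toReal_nonneg

theorem prob_true_add_false (p : PMF Bool) : prob p true + prob p false = 1 := by
  have h := p.tsum_coe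
  rw [tsum_fintype, Fintype.sum_bool] at h
  unfold prob
  rw [← ENNReal.toReal_add (p.apply_ne_top _) (p.apply_ne_top _), h]
  simp

theorem prob_add_not (p : PMF Bool) (b : Bool) : prob p b + prob p (!b) = 1 := by
  have := prob_true_add_false p
  cases b <;> simp <;> linarith

theorem prob_le_one (p : PMF Bool) (b : Bool) : prob p b ≤ 1 := by
  linarith [prob_add_not p b, prob_nonneg p (!b)]

theorem abs_prob_le_one (p : PMF Bool) (b : Bool) : |prob p b| ≤ 1 := by
  rw [abs_of_nonneg (prob_nonneg p b)]
  exact prob_le_one p b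

theorem prob_bind (p : PMF α) (f : α → PMF Bool) (b : Bool) :
    prob (p.bind f) b = expect p fun x => prob (f x) b := by
  unfold prob expect
  rw [PMF.bind_apply, ENNReal.tsum_toReal_eq]
  · simp
  · exact fun x => ENNReal.mul_ne_top (p.apply_ne_top _) ((f x).apply_ne_top _)

theorem prob_pure (b c : Bool) : prob (PMF.pure c) b = if b = c then 1 else 0 := by
  unfold prob
  rw [PMF.pure_apply]
  split_ifs <;> simp

theorem expect_bool (p : PMF Bool) (f : Bool → ℝ) :
    expect p f = prob p true * f true + prob p false * f false := by
  unfold expect prob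
  rw [tsum_fintype, Fintype.sum_bool]

theorem prob_coin_bind (f : Bool → PMF Bool) (b : Bool) :
    prob ((PMF.uniformOfFintype Bool).bind f) b = (prob (f false) b + prob (f true) b) / 2 := by
  rw [prob_bind, expect_bool]
  simp only [prob, PMF.uniformOfFintype_apply, Fintype.card_bool, ENNReal.toReal_inv]
  norm_num
  ring

theorem prob_map_congr (p : PMF α) {f g : α → Bool} {b c : Bool} (h : ∀ x, f x = b ↔ g x = c) :
    prob (p.map f) b = prob (p.map g) c := by
  unfold PMF.map
  rw [prob_bind, prob_bind]
  congr 1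
  funext x
  simp only [Function.comp, prob_pure]
  have := h x
  congr 1
  exact propext ⟨fun e => ((this.1 e.symm).symm), fun e => ((this.2 e.symm).symm)⟩

end Expect

/-! ## Circuits -/

section Circuits

theorem runC_nil {W : Type} [DecidableEq W] (w : W → Bool) : runC [] w = PMF.pure w := rfl

theorem runC_cons {W : Type} [DecidableEq W] (g : CGate W) (gs : List (CGate W)) (w : W → Bool) :
    runC (g :: gs) w = (g.run w).bind (runC gs) := rfl

theorem run_app {W : Type} [DecidableEq W] (f : Bool → Bool → Bool) (i j k : W) (w : W → Bool) :
    (CGate.app f i j k).run w = PMF.pure (Function.update w k (f (w i) (w j))) := rfl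

theorem run_copy {W : Type} [DecidableEq W] (i k : W) (w : W → Bool) :
    (CGate.copy i k).run w = PMF.pure (Function.update w k (w i)) := rfl

theorem run_coin {W : Type} [DecidableEq W] (k : W) (w : W → Bool) :
    (CGate.coin k).run w
      = (PMF.uniformOfFintype Bool).map fun b => Function.update w k b := rfl

theorem runC_append {W : Type} [DecidableEq W] (l₁ l₂ : List (CGate W)) (w : W → Bool) :
    runC (l₁ ++ l₂) w = (runC l₁ w).bind (runC l₂) := by
  induction l₁ generalizing w with
  | nil => simp [runC_nil]
  | cons g gs ih =>
    simp only [List.cons_append, runC_cons, PMF.bind_bind]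
    congr 1
    funext v
    exact ih v

theorem extend_update {W W' : Type} [DecidableEq W] [DecidableEq W'] {e : W → W'}
    (he : e.Injective) (v : W → Bool) (w : W' → Bool) (k : W) (b : Bool) :
    Function.extend e (Function.update v k b) w
      = Function.update (Function.extend e v w) (e k) b := by
  funext x
  by_cases hx : ∃ a, e a = x
  · obtain ⟨a, rfl⟩ := hx
    rw [he.extend_apply]
    by_cases h : a = k
    · subst h; simp
    · rw [Function.update_of_ne h, Function.update_of_ne (he.ne h), he.extend_apply]
  · rw [Function.extend_apply' _ _ _ hx, Function.update_of_ne, Function.extend_apply' _ _ _ hx]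
    rintro rfl
    exact hx ⟨k, rfl⟩

/-- Writing the contents as `Function.extend e v w`, with `v` on the range of `e` over a background
`w`, keeps this shape invariant under every moved gate. The induction over circuits then carries the
same `w` throughout. -/
theorem run_map {W W' : Type} [DecidableEq W] [DecidableEq W'] {e : W → W'} (he : e.Injective)
    (g : CGate W) (v : W → Bool) (w : W' → Bool) :
    (g.map e).run (Function.extend e v w) = (g.run v).map fun v => Function.extend e v w := by
  cases g with
  | app f i j k =>
    simp only [CGate.map, run_app, PMF.pure_map, he.extend_apply, extend_update he]
  | coin k =>
    simp only [CGate.map, run_coin, PMF.map_comp, Function.comp_def, extend_update he]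

theorem runC_map_extend {W W' : Type} [DecidableEq W] [DecidableEq W'] {e : W → W'}
    (he : e.Injective) (gs : List (CGate W)) (v : W → Bool) (w : W' → Bool) :
    runC (gs.map (CGate.map e)) (Function.extend e v w)
      = (runC gs v).map fun v => Function.extend e v w := by
  induction gs generalizing v with
  | nil => simp [runC_nil, PMF.pure_map]
  | cons g gs ih =>
    rw [List.map_cons, runC_cons, run_map he, PMF.bind_map, runC_cons, PMF.map_bind]
    congr 1
    funext v
    exact ih v

theorem extend_comp_self {W W' : Type} {e : W → W'} (he : e.Injective) (w : W' → Bool) :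
    Function.extend e (w ∘ e) w = w := by
  funext x
  by_cases hx : ∃ a, e a = x
  · obtain ⟨a, rfl⟩ := hx
    rw [he.extend_apply]; rfl
  · rw [Function.extend_apply' _ _ _ hx]

/-- A circuit moved along an injection `e` acts on the wires in the range of `e` only. -/
theorem runC_map {W W' : Type} [DecidableEq W] [DecidableEq W'] {e : W → W'}
    (he : e.Injective) (gs : List (CGate W)) (w : W' → Bool) :
    runC (gs.map (CGate.map e)) w
      = (runC gs (w ∘ e)).map fun v => Function.extend e v w := by
  conv_lhs => rw [← extend_comp_self he w]
  exact runC_map_extend he gs _ _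

variable {W Q : Type} [DecidableEq W] [Fintype Q] [DecidableEq Q]

theorem runQ_nil (s : (W → Bool) × QState Q) : runQ [] s = PMF.pure s := rfl

theorem runQ_cons (g : QGate W Q) (gs : List (QGate W Q)) (s : (W → Bool) × QState Q) :
    runQ (g :: gs) s = (g.run s).bind (runQ gs) := rfl

theorem runQ_append (l₁ l₂ : List (QGate W Q)) (s : (W → Bool) × QState Q) :
    runQ (l₁ ++ l₂) s = (runQ l₁ s).bind (runQ l₂) := by
  induction l₁ generalizing s with
  | nil => simp [runQ_nil]
  | cons g gs ih =>
    simp only [List.cons_append, runQ_cons, PMF.bind_bind]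
    congr 1
    funext v
    exact ih v

theorem runQ_classical (gs : List (CGate W)) (w : W → Bool) (ψ : QState Q) :
    runQ (gs.map QGate.classical) (w, ψ) = (runC gs w).map fun w => (w, ψ) := by
  induction gs generalizing w with
  | nil => simp [runC_nil, runQ_nil, PMF.pure_map]
  | cons g gs ih =>
    rw [List.map_cons, runQ_cons, runC_cons, PMF.map_bind]
    change ((g.run w).map fun w => (w, ψ)).bind _ = _
    rw [PMF.bind_map]
    congr 1
    funext v
    exact ih v

theorem runQ_map_extend {W' : Type} [DecidableEq W'] {e : W → W'} (he : e.Injective)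
    (gs : List (QGate W Q)) (v : W → Bool) (w : W' → Bool) (ψ : QState Q) :
    runQ (gs.map (QGate.map e)) (Function.extend e v w, ψ)
      = (runQ gs (v, ψ)).map fun s => (Function.extend e s.1 w, s.2) := by
  induction gs generalizing v ψ with
  | nil => simp [runQ_nil, PMF.pure_map]
  | cons g gs ih =>
    have h : (g.map e).run (Function.extend e v w, ψ)
        = (g.run (v, ψ)).map fun s => (Function.extend e s.1 w, s.2) := by
      cases g with
      | classical g =>
        change ((g.map e).run _).map (fun w => (w, ψ)) = ((g.run v).map fun w => (w, ψ)).map _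
        rw [run_map he, PMF.map_comp, PMF.map_comp]
        rfl
      | had t => simp only [QGate.run, QGate.map, PMF.pure_map]
      | tgate t => simp only [QGate.run, QGate.map, PMF.pure_map]
      | cnot c t h => simp only [QGate.run, QGate.map, PMF.pure_map]
      | ctrlX i t =>
        simp only [QGate.run, QGate.map, he.extend_apply, PMF.pure_map]
      | meas t k =>
        change (measOutcome t ψ).map
            (fun b => (Function.update (Function.extend e v w) (e k) b, collapse t b ψ))
          = ((measOutcome t ψ).map fun b => (Function.update v k b, collapse t b ψ)).map _
        rw [PMF.map_comp]
        simp only [Function.comp_def, extend_update he]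
    rw [List.map_cons, runQ_cons, h, PMF.bind_map, runQ_cons, PMF.map_bind]
    congr 1
    funext s
    exact ih s.1 s.2

theorem runQ_map {W' : Type} [DecidableEq W'] {e : W → W'} (he : e.Injective)
    (gs : List (QGate W Q)) (w : W' → Bool) (ψ : QState Q) :
    runQ (gs.map (QGate.map e)) (w, ψ)
      = (runQ gs (w ∘ e, ψ)).map fun s => (Function.extend e s.1 w, s.2) := by
  conv_lhs => rw [← extend_comp_self he w]
  exact runQ_map_extend he gs _ _ _

end Circuits

/-! ## Interactions -/

section Interact

variable {α β γ α' β' γ' : Type}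

/-- A move of the first party, on the joint state. -/
noncomputable def moveA (actA : ℕ → α × γ → PMF (α × γ)) (i : ℕ) (s : α × γ × β) : PMF (α × γ × β) :=
  (actA i (s.1, s.2.1)).map fun t => (t.1, t.2, s.2.2)

/-- A move of the second party, on the joint state. -/
noncomputable def moveB (actB : ℕ → β × γ → PMF (β × γ)) (i : ℕ) (s : α × γ × β) : PMF (α × γ × β) :=
  (actB i (s.2.2, s.2.1)).map fun t => (s.1, t.2, t.1)

/-- Splitting a round into two moves on the joint state lets simulations be checked one party at a
time. -/
theorem interact_succ (actA : ℕ → α × γ → PMF (α × γ)) (actB : ℕ → β × γ → PMF (β × γ))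
    (a : α) (c : γ) (b : β) (k : ℕ) :
    interact actA actB a c b (k + 1)
      = ((interact actA actB a c b k).bind (moveA actA k)).bind (moveB actB k) := by
  rw [PMF.bind_bind]
  change (interact actA actB a c b k).bind _ = _
  congr 1
  funext s
  rw [moveA, PMF.bind_map]
  rfl

theorem interact_congr {actA actA' : ℕ → α × γ → PMF (α × γ)}
    {actB actB' : ℕ → β × γ → PMF (β × γ)} (a : α) (c : γ) (b : β) (k : ℕ)
    (hA : ∀ i < k, actA i = actA' i) (hB : ∀ i < k, actB i = actB' i) :
    interact actA actB a c b k = interact actA' actB' a c b k := by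
  induction k with
  | zero => rfl
  | succ k ih =>
    rw [interact_succ, interact_succ, ih (fun i hi => hA i (by omega)) fun i hi => hB i (by omega)]
    unfold moveA moveB
    rw [hA k (by omega), hB k (by omega)]

/-- If `Φ` commutes with the moves of two interactions, it maps one to the other. -/
theorem interact_map (Φ : α × γ × β → α' × γ' × β') {actA : ℕ → α × γ → PMF (α × γ)}
    {actB : ℕ → β × γ → PMF (β × γ)} {actA' : ℕ → α' × γ' → PMF (α' × γ')}
    {actB' : ℕ → β' × γ' → PMF (β' × γ')} (a : α) (c : γ) (b : β) (a' : α') (c' : γ') (b' : β')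
    (h0 : Φ (a, c, b) = (a', c', b')) (k : ℕ)
    (hA : ∀ i < k, ∀ s, moveA actA' i (Φ s) = (moveA actA i s).map Φ)
    (hB : ∀ i < k, ∀ s, moveB actB' i (Φ s) = (moveB actB i s).map Φ) :
    interact actA' actB' a' c' b' k = (interact actA actB a c b k).map Φ := by
  induction k with
  | zero => exact ((PMF.pure_map _ _).trans (by rw [h0]; rfl)).symm
  | succ k ih =>
    rw [interact_succ, interact_succ, ih (fun i hi => hA i (by omega)) fun i hi => hB i (by omega),
      PMF.bind_map, PMF.map_bind, PMF.bind_bind, PMF.bind_bind]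
    congr 1
    funext s
    rw [Function.comp, hA k (by omega), PMF.bind_map]
    congr 1
    funext s
    exact hB k (by omega) s

/-- If the first party begins by a random choice of its memory, that choice can be made before
the interaction. -/
theorem interact_random_start {actA actA' : ℕ → α × γ → PMF (α × γ)}
    {actB : ℕ → β × γ → PMF (β × γ)} (a : α) (c : γ) (b : β) (p : PMF α) (k : ℕ)
    (h0 : actA 0 (a, c) = p.bind fun a' => actA' 0 (a', c)) (hs : ∀ i, actA (i + 1) = actA' (i + 1)) :
    interact actA actB a c b (k + 1) = p.bind fun a' => interact actA' actB a' c b (k + 1) := by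
  induction k with
  | zero =>
    simp only [interact_succ]
    change ((PMF.pure (a, c, b)).bind _).bind _
      = p.bind fun a' => ((PMF.pure (a', c, b)).bind _).bind _
    simp only [PMF.pure_bind]
    rw [← PMF.bind_bind]
    congr 1
    unfold moveA
    dsimp only
    rw [h0, PMF.map_bind]
  | succ k ih =>
    rw [interact_succ, ih]
    simp only [interact_succ _ _ _ _ _ (k + 1)]
    rw [PMF.bind_bind, PMF.bind_bind]
    congr 1
    funext a'
    rw [← PMF.bind_bind]
    unfold moveA
    rw [hs]

/-- What the first party has after its move is not affected by the move of the second party. -/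
theorem moveB_map_fst {δ : Type} (actB : ℕ → β × γ → PMF (β × γ)) (i : ℕ) (s : α × γ × β)
    (f : α → δ) : (moveB actB i s).map (fun z => f z.1) = PMF.pure (f s.1) := by
  rw [moveB, PMF.map_comp]
  exact PMF.map_const (actB i (s.2.2, s.2.1)) (f s.1)

end Interact

/-! ## The verifier of the CHSH test -/

section Verifier

variable {C : Type}

/-- The action of a circuit on a private memory and the message register. -/
noncomputable def circAct {M C : Type} [DecidableEq M] [DecidableEq C] (gs : List (CGate (M ⊕ C)))
    (s : (M → Bool) × (C → Bool)) : PMF ((M → Bool) × (C → Bool)) :=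
  (runC gs (Sum.elim s.1 s.2)).map fun w => (w ∘ Sum.inl, w ∘ Sum.inr)

theorem ClassicalParty.act_eq [DecidableEq C] (P : ClassicalParty C) (i : ℕ) :
    P.act i = circAct (P.turn i) := rfl

/-- The action of a quantum circuit on a private memory, private qubits and the message
register. -/
noncomputable def circActQ {M C Q : Type} [DecidableEq M] [DecidableEq C] [Fintype Q]
    [DecidableEq Q] (gs : List (QGate (M ⊕ C) Q)) (s : ((M → Bool) × QState Q) × (C → Bool)) :
    PMF (((M → Bool) × QState Q) × (C → Bool)) :=
  (runQ gs (Sum.elim s.1.1 s.2, s.1.2)).map fun s => ((s.1 ∘ Sum.inl, s.2), s.1 ∘ Sum.inr)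

theorem QuantumParty.act_eq [DecidableEq C] (P : QuantumParty C) (i : ℕ) :
    P.act i = circActQ (P.turn i) := rfl

theorem circActQ_append {M C Q : Type} [DecidableEq M] [DecidableEq C] [Fintype Q]
    [DecidableEq Q] (l₁ l₂ : List (QGate (M ⊕ C) Q)) (s : ((M → Bool) × QState Q) × (C → Bool)) :
    circActQ (l₁ ++ l₂) s = (circActQ l₁ s).bind (circActQ l₂) := by
  rw [circActQ, runQ_append, circActQ, PMF.bind_map, PMF.map_bind]
  congr 1
  funext w
  rw [Function.comp, circActQ, Sum.elim_comp_inl_inr]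

theorem circActQ_classical {M C Q : Type} [DecidableEq M] [DecidableEq C] [Fintype Q]
    [DecidableEq Q] (gs : List (CGate (M ⊕ C))) (s : ((M → Bool) × QState Q) × (C → Bool)) :
    circActQ (gs.map QGate.classical) s
      = (circAct gs (s.1.1, s.2)).map fun t => ((t.1, s.1.2), t.2) := by
  rw [circActQ, runQ_classical, circAct, PMF.map_comp, PMF.map_comp]
  rfl

/-- The sender, acting on a message register with one more bit, which it ignores. -/
noncomputable def Sender.liftAct [DecidableEq C] (S : Sender C) (i : ℕ)
    (s : (S.Mem → Bool) × (C ⊕ Unit → Bool)) : PMF ((S.Mem → Bool) × (C ⊕ Unit → Bool)) :=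
  (S.act i (s.1, s.2 ∘ Sum.inl)).map fun t => (t.1, Sum.elim t.2 (s.2 ∘ Sum.inr))

theorem senderWire_injective (S : Sender C) : (senderWire S).Injective :=
  Sum.inl_injective.sumMap Sum.inl_injective

/-- The turns of the CHSH verifier without the choice of its input to the OSP. -/
def chshTurn (k : ℕ) (S : Sender C) (i : ℕ) : List (CGate ((S.Mem ⊕ CHSHBit) ⊕ (C ⊕ Unit))) :=
  if i < k then (S.turn i).map (CGate.map (senderWire S))
  else if i = k then
    [.coin (.inl (.inr .a)), .copy (.inl (.inr .a)) (.inr (.inr ()))]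
  else if i = k + 1 then
    [.app Bool.and (.inl (.inr .r)) (.inl (.inr .a)) (.inl (.inr .verdict)),
      .app Bool.xor (.inl (.inr .verdict)) (.inl (.inl S.out)) (.inl (.inr .verdict)),
      .app (fun x y => x == y) (.inl (.inr .verdict)) (.inr (.inr ())) (.inl (.inr .verdict))]
  else []

/-- The turns of the CHSH verifier. -/
def chshFullTurn (k : ℕ) (S : Sender C) (i : ℕ) :
    List (CGate ((S.Mem ⊕ CHSHBit) ⊕ (C ⊕ Unit))) :=
  (if i = 0 then [.coin (.inl (.inr .r)), .copy (.inl (.inr .r)) (.inl (.inl S.inp))] else [])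
    ++ chshTurn k S i

variable [DecidableEq C]

/-- The memory of the CHSH verifier when it has sampled `r`. -/
def chshMem (S : Sender C) (m : S.Mem → Bool) (r : Bool) : S.Mem ⊕ CHSHBit → Bool :=
  Sum.elim m (Function.update (fun _ => false) .r r)

/-- All memory is initially zero, so copying `r` to the input wire produces exactly `S.init r`. The
hypothesis `h0` of `interact_random_start` has this form. -/
theorem chshVerifier_act_zero (k : ℕ) (S : Sender C) :
    circAct (chshFullTurn k S 0) (fun _ => false, fun _ => false)
      = ((PMF.uniformOfFintype Bool).map fun r => chshMem S (S.init r) r).bind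
          fun m => circAct (chshTurn k S 0) (m, fun _ => false) := by
  have h : chshFullTurn k S 0
      = [.coin (.inl (.inr .r)), .copy (.inl (.inr .r)) (.inl (.inl S.inp))]
        ++ chshTurn k S 0 := rfl
  rw [circAct, h, PMF.bind_map, runC_append, runC_cons, run_coin, PMF.bind_map, PMF.bind_bind,
    PMF.map_bind]
  congr 1
  funext r
  simp only [Function.comp, runC_cons, run_copy, PMF.pure_bind, runC_nil]
  rw [circAct]
  congr 2
  funext x
  rcases x with (x | x) | x
  · by_cases hx : x = S.inp
    · subst hx; simp [chshMem, Sender.init]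
    · simp [chshMem, Sender.init, hx]
  · cases x <;> simp [chshMem, -Sum.elim_update_right]
  · simp

/-- The range of `senderWire` misses the verifier's own bits and the extra message bit, so a
relocated sender circuit leaves them as they were. -/
theorem chshTurn_act_lt {k i : ℕ} (hi : i < k) (S : Sender C) (m : S.Mem → Bool)
    (r : Bool) (c : C ⊕ Unit → Bool) :
    circAct (chshTurn k S i) (chshMem S m r, c)
      = (S.liftAct i (m, c)).map fun t => (chshMem S t.1 r, t.2) := by
  have h : chshTurn k S i = (S.turn i).map (CGate.map (senderWire S)) := if_pos hi
  have hw : (Sum.elim (chshMem S m r) c : (S.Mem ⊕ CHSHBit) ⊕ (C ⊕ Unit) → Bool) ∘ senderWire S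
      = Sum.elim m (c ∘ Sum.inl) := by
    funext x
    rcases x with x | x <;> rfl
  rw [circAct, h]
  refine (congrArg _ (runC_map (senderWire_injective S) _ _)).trans ?_
  rw [hw, Sender.liftAct, ClassicalParty.act_eq, circAct, PMF.map_comp, PMF.map_comp, PMF.map_comp]
  congr 1
  funext v
  have he (x) : Function.extend (senderWire S) v (Sum.elim (chshMem S m r) c) (senderWire S x)
      = v x := (senderWire_injective S).extend_apply _ _ _
  refine Prod.ext ?_ ?_ <;> funext x <;> rcases x with x | x
  · exact he (.inl x)
  · refine (Function.extend_apply' _ _ _ ?_).trans rfl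
    rintro ⟨y | y, hy⟩ <;> simp [senderWire] at hy
  · exact he (.inr x)
  · refine (Function.extend_apply' _ _ _ ?_).trans rfl
    rintro ⟨y | y, hy⟩ <;> simp [senderWire] at hy

theorem chshTurn_act_challenge (k : ℕ) (S : Sender C) (m : S.Mem ⊕ CHSHBit → Bool)
    (c : C ⊕ Unit → Bool) :
    circAct (chshTurn k S k) (m, c)
      = (PMF.uniformOfFintype Bool).map fun a =>
          (Function.update m (.inr .a) a, Function.update c (.inr ()) a) := by
  have h : chshTurn k S k
      = [.coin (.inl (.inr .a)), .copy (.inl (.inr .a)) (.inr (.inr ()))] := by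
    simp [chshTurn]
  rw [circAct, h]
  simp only [runC_cons, runC_nil, run_copy, run_coin, PMF.bind_map, PMF.map_bind,
    PMF.pure_bind, Function.comp_def, PMF.pure_map]
  refine (PMF.bind_pure_comp _ _).trans ?_
  congr 1
  funext a
  refine Prod.ext ?_ ?_ <;> funext x <;> rcases x with x | x
  all_goals simp only [Function.update_apply, Sum.elim_inl, Sum.elim_inr,
    reduceCtorEq, if_false, if_true, Sum.inl.injEq, Sum.inr.injEq]

theorem chshTurn_act_verdict (k : ℕ) (S : Sender C) (m : S.Mem ⊕ CHSHBit → Bool)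
    (c : C ⊕ Unit → Bool) :
    (circAct (chshTurn k S (k + 1)) (m, c)).map (fun t => t.1 (.inr .verdict))
      = PMF.pure (((m (.inr .r) && m (.inr .a)) ^^ m (.inl S.out)) == c (.inr ())) := by
  have h : chshTurn k S (k + 1)
      = [.app Bool.and (.inl (.inr .r)) (.inl (.inr .a)) (.inl (.inr .verdict)),
        .app Bool.xor (.inl (.inr .verdict)) (.inl (.inl S.out)) (.inl (.inr .verdict)),
        .app (fun x y => x == y) (.inl (.inr .verdict)) (.inr (.inr ()))
          (.inl (.inr .verdict))] := by
    simp [chshTurn]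
  rw [circAct, h]
  simp only [runC_cons, runC_nil, run_app, PMF.pure_bind, PMF.pure_map]
  congr 1

/-- The verdict of the CHSH verifier, in terms of the interaction of the OSP sender with the
prover. -/
theorem chshVerifier_verdict {β : Type} (k : ℕ) (S : Sender C)
    (actB : ℕ → β × (C ⊕ Unit → Bool) → PMF (β × (C ⊕ Unit → Bool))) (b : β) :
    (interact (chshVerifier k S).act actB (fun _ => false) (fun _ => false) b (k + 2)).map
        (fun z => z.1 (chshVerifier k S).out)
      = (PMF.uniformOfFintype Bool).bind fun r =>
          (interact S.liftAct actB (S.init r) (fun _ => false) b k).bind fun s =>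
            (PMF.uniformOfFintype Bool).bind fun a =>
              (actB k (s.2.2, Function.update s.2.1 (.inr ()) a)).map fun t =>
                ((r && a) ^^ s.1 S.out) == t.2 (.inr ()) := by
  change (interact (fun i => circAct (chshFullTurn k S i)) actB (fun _ => false) (fun _ => false) b
    (k + 2)).map (fun z => z.1 (.inr .verdict)) = _
  have h1 := interact_random_start (actA := fun i => circAct (chshFullTurn k S i))
    (actA' := fun i => circAct (chshTurn k S i)) (actB := actB) (fun _ => false)
    (fun _ => false) b _
    (k + 1) (chshVerifier_act_zero k S) (fun _ => rfl)
  rw [h1, PMF.bind_map, PMF.map_bind]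
  congr 1
  funext r
  have h2 := interact_map (fun z : (S.Mem → Bool) × (C ⊕ Unit → Bool) × β =>
      (chshMem S z.1 r, z.2.1, z.2.2)) (actA := S.liftAct) (actB := actB)
    (actA' := fun i => circAct (chshTurn k S i)) (actB' := actB)
    (S.init r) (fun _ => false) b (chshMem S (S.init r) r) (fun _ => false) b rfl k
    (fun i hi s => by
      unfold moveA
      rw [PMF.map_comp]
      refine (congrArg _ (chshTurn_act_lt hi S s.1 r s.2.1)).trans ?_
      rw [PMF.map_comp]
      rfl)
    (fun i hi s => by
      unfold moveB
      rw [PMF.map_comp]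
      rfl)
  simp only [Function.comp]
  rw [interact_succ, interact_succ, PMF.map_bind]
  -- The prover still moves once after the verdict is computed, but it cannot reach the verifier's
  -- memory.
  have h3 : ∀ s : ((S.Mem ⊕ CHSHBit → Bool) × (C ⊕ Unit → Bool) × β),
      (moveB actB (k + 1) s).map (fun z => z.1 (.inr .verdict))
        = PMF.pure (s.1 (.inr .verdict)) :=
    fun s => moveB_map_fst actB (k + 1) s fun m => m (.inr .verdict)
  rw [funext h3, PMF.bind_bind]
  have h4 : ∀ s : ((S.Mem ⊕ CHSHBit → Bool) × (C ⊕ Unit → Bool) × β),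
      (moveA (fun i => circAct (chshTurn k S i)) (k + 1) s).bind
          (fun z => PMF.pure (z.1 (.inr .verdict)))
        = PMF.pure (((s.1 (.inr .r) && s.1 (.inr .a)) ^^ s.1 (.inl S.out)) == s.2.1 (.inr ())) := by
    intro s
    rw [moveA, PMF.bind_map]
    exact chshTurn_act_verdict k S s.1 s.2.1
  rw [funext h4, PMF.bind_bind]
  rw [h2, PMF.bind_map, PMF.bind_bind]
  congr 1
  funext s
  rw [Function.comp, moveA]
  rw [chshTurn_act_challenge, PMF.map_comp, PMF.bind_map]
  congr 1
  funext a
  simp only [Function.comp, moveB]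
  rw [PMF.bind_map]
  refine (PMF.bind_pure_comp _ _).trans ?_
  congr 1

end Verifier

/-! ## The measurement of the honest prover -/

section Measurement

variable {Q : Type} [DecidableEq Q]

/-- The unitary that the honest prover applies before measuring in the computational basis. -/
noncomputable def chshRot (a : Bool) (t : Q) (ψ : QVec Q) : QVec Q :=
  hadV t (tV t (hadV t (tV t (tV t (hadV t (if a then xV t (hadV t ψ) else hadV t ψ))))))

/-- This form makes everything polynomial in `1/√2` and `i`, so that later identities need only
`(1/√2)² = 1/2` and `i² = -1`. -/
theorem exp_pi_div_four :
    Complex.exp (Real.pi / 4 * Complex.I) = ((1 / √2 : ℝ) : ℂ) * (1 + Complex.I) := by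
  have h : (Real.pi / 4 : ℂ) = ((Real.pi / 4 : ℝ) : ℂ) := by push_cast; rfl
  have h2 : √2 / 2 = 1 / √2 := by
    rw [div_eq_div_iff (by norm_num) (by positivity), Real.mul_self_sqrt (by norm_num)]
    norm_num
  rw [h, Complex.exp_mul_I, ← Complex.ofReal_cos, ← Complex.ofReal_sin, Real.cos_pi_div_four,
    Real.sin_pi_div_four, h2]
  ring

theorem inv_sqrt_two_sq : (1 / √2) ^ 2 = 1 / 2 := by
  rw [div_pow, Real.sq_sqrt (by norm_num)]; norm_num

/-- The gates amount to `H T H T² Z^a`: the conjugated `X` is `Z^a`, and `T²` contributes the phase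
`i`. Only the two amplitudes at labels differing from `x` at most at `t` enter, so the statement
concerns a single qubit. -/
theorem chshRot_apply (a b : Bool) (t : Q) (ψ : QVec Q) (x : Q → Bool) :
    chshRot a t ψ (Function.update x t b) = 1 / 2 *
      ((ψ (Function.update x t false)
          + (if a then -1 else 1) * Complex.I * ψ (Function.update x t true))
        + (if b then -1 else 1) * (((1 / √2 : ℝ) : ℂ) * (1 + Complex.I))
          * (ψ (Function.update x t false)
            - (if a then -1 else 1) * Complex.I * ψ (Function.update x t true))) := by
  have hk : ((1 / √2 : ℝ) : ℂ) ^ 2 = 1 / 2 := by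
    rw [← Complex.ofReal_pow, inv_sqrt_two_sq]; norm_num
  have hI := Complex.I_sq
  rw [← exp_pi_div_four]
  -- With `ω² = i` and `k² = 1/2` as the only relations, each case below is a polynomial identity;
  -- `k ^ 4` collects the normalizations of the four Hadamard gates.
  have hw : Complex.exp (Real.pi / 4 * Complex.I) ^ 2 = Complex.I := by
    rw [exp_pi_div_four]
    linear_combination (1 + Complex.I) ^ 2 * hk + 1 / 2 * hI
  cases a <;> cases b <;>
  simp only [chshRot, hadV, tV, xV, flipBit, Function.update_self, Function.update_idem, if_true,
      Bool.false_eq_true, if_false, Bool.not_true, Bool.not_false] <;>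
  generalize Complex.exp (Real.pi / 4 * Complex.I) = ω at hw <;>
  generalize ((1 / √2 : ℝ) : ℂ) = k at hk <;>
  generalize ψ (Function.update x t false) = α <;>
  generalize ψ (Function.update x t true) = β <;>
  rw [← hw] <;>
  have hk4 : k ^ 4 = 1 / 4 := by rw [show k ^ 4 = (k ^ 2) ^ 2 by ring, hk]; norm_num
  · linear_combination (2 * ((α + ω ^ 2 * β) + ω * (α - ω ^ 2 * β))) * hk4
  · linear_combination (2 * ((α + ω ^ 2 * β) - ω * (α - ω ^ 2 * β))) * hk4
  · linear_combination (2 * ((α - ω ^ 2 * β) + ω * (α + ω ^ 2 * β))) * hk4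
  · linear_combination (2 * ((α - ω ^ 2 * β) - ω * (α + ω ^ 2 * β))) * hk4

variable [Fintype Q]

/-- Each label with value `b` at `t` arises from two labels `x`, itself and its flip. Norms on the
whole register thus become sums of one-qubit expressions, and identities can be proved summand by
summand. -/
theorem sum_update (t : Q) (b : Bool) (g : (Q → Bool) → ℝ) :
    ∑ x, g (Function.update x t b) = 2 * ∑ x, if x t = b then g x else 0 := by
  have h : ∀ x : Q → Bool, g (Function.update x t b)
      = (if x t = b then g x else 0)
        + (if (flipBit t x) t = b then g (flipBit t x) else 0) := by
    intro x
    by_cases hx : x t = b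
    · subst hx
      simp [flipBit]
    · have hb : b = !x t := by cases b <;> cases hxt : x t <;> simp_all
      subst hb
      simp [flipBit]
  rw [Finset.sum_congr rfl fun x _ => h x, Finset.sum_add_distrib, two_mul]
  congr 1
  exact Equiv.sum_comp (flipBit_invol t).toPerm fun x => if x t = b then g x else 0

theorem norm_projV_sq (t : Q) (b : Bool) (ψ : QVec Q) :
    ‖projV t b ψ‖ ^ 2 = (∑ x, ‖ψ (Function.update x t b)‖ ^ 2) / 2 := by
  rw [sum_update t b fun x => ‖ψ x‖ ^ 2, EuclideanSpace.norm_sq_eq, mul_div_cancel_left₀ _ two_ne_zero]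
  refine Finset.sum_congr rfl fun x _ => ?_
  by_cases hx : x t = b <;> simp [projV, hx]

theorem norm_sq_eq_sum_update (t : Q) (ψ : QVec Q) :
    ‖ψ‖ ^ 2 = (∑ x, (‖ψ (Function.update x t true)‖ ^ 2
      + ‖ψ (Function.update x t false)‖ ^ 2)) / 2 := by
  rw [← norm_projV_add t ψ, norm_projV_sq, norm_projV_sq, Finset.sum_add_distrib, add_div]

theorem ospNorm_sq (r s : Bool) (t : Q) (ψ : QVec Q) :
    OSPProtocol.ospNorm r s t ψ ^ 2 = ‖projV t s (OSPProtocol.hadPow r t ψ)‖ ^ 2 := by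
  cases r <;> simp [OSPProtocol.ospNorm, OSPProtocol.hadPow, norm_hadV]

/-- Averaged over the challenge, the projector on the correct answers is
`1/2 + (2 Π_r - 1) / (2 √2)`. -/
theorem sum_norm_projV_chshRot (r s : Bool) (t : Q) (ψ : QVec Q) :
    ‖projV t ((r && false) ^^ s) (chshRot false t ψ)‖ ^ 2
        + ‖projV t ((r && true) ^^ s) (chshRot true t ψ)‖ ^ 2
      = ‖ψ‖ ^ 2 + 1 / √2 * (2 * OSPProtocol.ospNorm r s t ψ ^ 2 - ‖ψ‖ ^ 2) := by
  have hk := inv_sqrt_two_sq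
  rw [ospNorm_sq, norm_sq_eq_sum_update t ψ, norm_projV_sq, norm_projV_sq, norm_projV_sq,
    ← add_div, ← Finset.sum_add_distrib, mul_div_assoc', ← sub_div, Finset.mul_sum,
    ← Finset.sum_sub_distrib, mul_div_assoc', ← add_div, Finset.mul_sum, ← Finset.sum_add_distrib]
  -- What remains is an identity for the pair of amplitudes `α`, `β` over each `x`. In real
  -- coordinates it holds modulo `k² = 1/2`.
  congr 1
  refine Finset.sum_congr rfl fun x _ => ?_
  rw [chshRot_apply, chshRot_apply]
  cases r <;> cases s <;>
  simp only [OSPProtocol.hadPow, hadV, Function.update_self, Function.update_idem, if_true,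
      Bool.false_eq_true, if_false, Bool.and_true, Bool.and_false, Bool.xor_false, Bool.xor_true,
      Bool.not_true, Bool.not_false] <;>
  generalize (1 / √2 : ℝ) = k at hk <;>
  generalize ψ (Function.update x t false) = α <;>
  generalize ψ (Function.update x t true) = β <;>
  simp only [Complex.sq_norm, Complex.normSq_apply, Complex.add_re, Complex.add_im, Complex.mul_re,
    Complex.mul_im, Complex.sub_re, Complex.sub_im, Complex.I_re, Complex.I_im, Complex.one_re,
    Complex.one_im, Complex.ofReal_re, Complex.ofReal_im, Complex.neg_re, Complex.neg_im,
    Complex.div_ofNat_re, Complex.div_ofNat_im]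
  · linear_combination (α.re ^ 2 + α.im ^ 2 + β.re ^ 2 + β.im ^ 2) * hk
  · linear_combination (α.re ^ 2 + α.im ^ 2 + β.re ^ 2 + β.im ^ 2) * hk
  · linear_combination ((α.re ^ 2 + α.im ^ 2 + β.re ^ 2 + β.im ^ 2)
      - 2 * k * ((α.re + β.re) ^ 2 + (α.im + β.im) ^ 2)) * hk
  · linear_combination ((α.re ^ 2 + α.im ^ 2 + β.re ^ 2 + β.im ^ 2)
      - 2 * k * ((α.re - β.re) ^ 2 + (α.im - β.im) ^ 2)) * hk

theorem prob_measOutcome (t : Q) (b : Bool) (ψ : QState Q) :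
    prob (measOutcome t ψ) b = ‖projV t b ψ.1‖ ^ 2 := by
  unfold prob measOutcome
  rw [PMF.ofFintype_apply, ENNReal.toReal_ofReal (by positivity)]

/-- The answer of the honest prover is the outcome of measuring its rotated output qubit. -/
theorem measureCHSH_answer {M C : Type} [DecidableEq M] [DecidableEq C] (w : C) (t : Q)
    (m : M → Bool) (ψ : QState Q) (c : C → Bool) :
    ∃ φ : QState Q, φ.1 = chshRot (c w) t ψ.1 ∧
      (circActQ (measureCHSH (.inr w) t) ((m, ψ), c)).map (fun s => s.2 w)
        = measOutcome t φ := by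
  refine ⟨⟨chshRot (c w) t ψ.1, ?_⟩, rfl, ?_⟩
  · unfold chshRot
    cases c w <;> simp [norm_hadV, norm_tV, norm_xV, ψ.2]
  · have h : ∀ φ φ' : QState Q, φ = φ' →
        ((((measOutcome t φ).bind fun b => PMF.pure ((Function.update (Sum.elim m c) (.inr w) b :
            M ⊕ C → Bool), collapse t b φ)).bind (runQ [])).map fun s =>
          ((s.1 ∘ Sum.inl, s.2), s.1 ∘ Sum.inr)).map (fun s => s.2 w) = measOutcome t φ' := by
      rintro φ _ rfl
      rw [PMF.map_comp, PMF.map_bind, PMF.bind_bind]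
      simp only [PMF.pure_bind, runQ_nil, PMF.pure_map, Function.comp, Function.update_self]
      exact PMF.bind_pure _
    unfold circActQ measureCHSH
    simp only [runQ_cons, QGate.run, PMF.pure_bind, Sum.elim_inr]
    refine h _ _ (Subtype.ext ?_)
    unfold chshRot
    dsimp only
    congr 6
    -- The gate `ctrlX` branches between bundled states, while `chshRot` branches between vectors.
    exact apply_ite Subtype.val _ _ _

end Measurement

/-! ## Completeness -/

section Completeness

variable {C : Type} [DecidableEq C]

/-- The turns of the honest prover. -/
def proverTurn (k : ℕ) (R : Receiver C) (i : ℕ) : List (QGate (R.Mem ⊕ (C ⊕ Unit)) R.Qub) :=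
  if i < k then (R.turn i).map (QGate.map (Sum.map id Sum.inl))
  else if i = k then measureCHSH (.inr (.inr ())) R.outQubit
  else []

theorem proverTurn_act_lt {k i : ℕ} (hi : i < k) (R : Receiver C)
    (s : ((R.Mem → Bool) × QState R.Qub)) (c : C → Bool) (u : Unit → Bool) :
    circActQ (proverTurn k R i) (s, Sum.elim c u)
      = (R.act i (s, c)).map fun t => (t.1, Sum.elim t.2 u) := by
  obtain ⟨m, ψ⟩ := s
  have h : proverTurn k R i = (R.turn i).map (QGate.map (Sum.map id Sum.inl)) := if_pos hi
  have hinj : (Sum.map id Sum.inl : R.Mem ⊕ C → R.Mem ⊕ (C ⊕ Unit)).Injective :=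
    Function.injective_id.sumMap Sum.inl_injective
  have hw : (Sum.elim m (Sum.elim c u) : R.Mem ⊕ (C ⊕ Unit) → Bool) ∘ Sum.map id Sum.inl
      = Sum.elim m c := by
    funext x
    rcases x with x | x <;> rfl
  rw [circActQ, h]
  dsimp only
  rw [runQ_map hinj, hw, QuantumParty.act_eq, circActQ, PMF.map_comp, PMF.map_comp]
  congr 1
  funext v
  have he (x) : Function.extend (Sum.map id Sum.inl) v.1
      (Sum.elim m (Sum.elim c u) : R.Mem ⊕ (C ⊕ Unit) → Bool) (Sum.map id Sum.inl x)
      = v.1 x := hinj.extend_apply _ _ _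
  refine Prod.ext (Prod.ext ?_ rfl) ?_ <;> funext x
  · exact he (.inl x)
  · rcases x with x | x
    · exact he (.inr x)
    · refine (Function.extend_apply' _ _ _ ?_).trans rfl
      rintro ⟨y | y, hy⟩ <;> simp at hy

/-- The OSP phase of the honest run of the CHSH test is the honest run of the OSP. -/
theorem interact_proverTurn (k : ℕ) (S : Sender C) (R : Receiver C) (m : S.Mem → Bool) :
    interact S.liftAct (fun i => circActQ (proverTurn k R i)) m (fun _ => false) R.init k
      = (interact S.act R.act m (fun _ => false) R.init k).map
          fun z => (z.1, Sum.elim z.2.1 (fun _ => false), z.2.2) := by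
  refine interact_map _ _ _ _ _ _ _ ?_ k ?_ ?_
  · refine Prod.ext rfl (Prod.ext ?_ rfl)
    funext x
    rcases x with x | x <;> rfl
  · intro i _ s
    rw [moveA, moveA, Sender.liftAct, PMF.map_comp, PMF.map_comp]
    rfl
  · intro i hi s
    rw [moveB, moveB, proverTurn_act_lt hi, PMF.map_comp, PMF.map_comp]
    rfl

theorem ospNorm_nonneg {Q : Type} [Fintype Q] [DecidableEq Q] (r s : Bool) (t : Q) (ψ : QVec Q) :
    0 ≤ OSPProtocol.ospNorm r s t ψ := norm_nonneg _

theorem ospNorm_le_one {Q : Type} [Fintype Q] [DecidableEq Q] (r s : Bool) (t : Q)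
    (ψ : QState Q) : OSPProtocol.ospNorm r s t ψ.1 ≤ 1 := by
  have h1 := ospNorm_sq r s t ψ.1
  have h2 := norm_projV_add t (OSPProtocol.hadPow r t ψ.1)
  have h3 : ‖OSPProtocol.hadPow r t ψ.1‖ = 1 := by
    cases r <;> simp [OSPProtocol.hadPow, norm_hadV, ψ.2]
  rw [h3] at h2
  have h4 : OSPProtocol.ospNorm r s t ψ.1 ^ 2 ≤ 1 := by
    rw [h1]
    cases s <;> nlinarith [sq_nonneg ‖projV t true (OSPProtocol.hadPow r t ψ.1)‖,
      sq_nonneg ‖projV t false (OSPProtocol.hadPow r t ψ.1)‖]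
  nlinarith [ospNorm_nonneg r s t ψ.1]

theorem cos_sq_pi_div_eight : Real.cos (Real.pi / 8) ^ 2 = 1 / 2 + 1 / √2 / 2 := by
  have h2 : √2 / 2 = 1 / √2 := by
    rw [div_eq_div_iff (by norm_num) (by positivity), Real.mul_self_sqrt (by norm_num)]
    norm_num
  rw [Real.cos_sq, show 2 * (Real.pi / 8) = Real.pi / 4 by ring, Real.cos_pi_div_four, h2]

/-- The honest prover wins with probability at least `cos² (π/8)`, up to the correctness error of
its OSP output state. -/
theorem prob_chsh_answer (k : ℕ) (R : Receiver C) (r s : Bool) (m : R.Mem → Bool)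
    (ψ : QState R.Qub) (c : C ⊕ Unit → Bool) :
    Real.cos (Real.pi / 8) ^ 2 - 2 * (1 - OSPProtocol.ospNorm r s R.outQubit ψ.1)
      ≤ prob ((PMF.uniformOfFintype Bool).bind fun a =>
        (circActQ (proverTurn k R k) ((m, ψ), Function.update c (.inr ()) a)).map fun t =>
          ((r && a) ^^ s) == t.2 (.inr ())) true := by
  have h : ∀ a, prob ((circActQ (proverTurn k R k) ((m, ψ), Function.update c (.inr ()) a)).map
      fun t => ((r && a) ^^ s) == t.2 (.inr ())) true
      = ‖projV R.outQubit ((r && a) ^^ s) (chshRot a R.outQubit ψ.1)‖ ^ 2 := by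
    intro a
    obtain ⟨φ, h1, h2⟩ := measureCHSH_answer (.inr ()) R.outQubit m ψ
      (Function.update c (.inr ()) a)
    have h3 : proverTurn k R k = measureCHSH (.inr (.inr ())) R.outQubit := by simp [proverTurn]
    rw [Function.update_self] at h1
    rw [← h1, ← prob_measOutcome, ← h2, h3, ← PMF.map_id (PMF.map _ _), PMF.map_comp]
    refine (prob_map_congr _ fun x => ?_)
    simp only [beq_iff_eq, Function.comp, id]
    exact eq_comm
  rw [prob_coin_bind, h, h, sum_norm_projV_chshRot, ψ.2, cos_sq_pi_div_eight]
  have h0 := ospNorm_nonneg r s R.outQubit ψ.1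
  have h1 := ospNorm_le_one r s R.outQubit ψ
  have hk : 1 / √2 ≤ 1 := by
    have := inv_sqrt_two_sq
    nlinarith
  have hk0 : 0 < 1 / √2 := by positivity
  generalize OSPProtocol.ospNorm r s R.outQubit ψ.1 = q at *
  generalize 1 / √2 = κ at *
  -- The claim reduces to `κ (1 - q²) ≤ 2 (1 - q)`, which is `κ (1 + q) ≤ 2` multiplied by `1 - q ≥
  -- 0`.
  nlinarith [mul_le_mul hk (by linarith : 1 + q ≤ 2) (by linarith) zero_le_one,
    mul_nonneg (sub_nonneg.2 h1) (sub_nonneg.2 (mul_le_mul hk (by linarith : 1 + q ≤ 2)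
      (by linarith) zero_le_one))]

end Completeness

/-- The honest prover passes the CHSH test with probability at least `cos² (π/8)`, up to the
correctness error of the OSP. -/
theorem chshTest_honestAccept (O : OSPProtocol) (n : ℕ) :
    Real.cos (Real.pi / 8) ^ 2 - (∑ r : Bool, (1 - expect (O.interaction n r
        (O.receiver n).toQuantumParty) fun z => OSPProtocol.ospNorm r (z.1 (O.sender n).out)
          (O.receiver n).outQubit z.2.2.2.1))
      ≤ (chshTest O).honestAccept n := by
  have h := chshVerifier_verdict (O.rounds n) (O.sender n)
    (fun i => circActQ (proverTurn (O.rounds n) (O.receiver n) i)) (O.receiver n).init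
  change _ ≤ prob ((interact (chshVerifier (O.rounds n) (O.sender n)).act
    (fun i => circActQ (proverTurn (O.rounds n) (O.receiver n) i)) (fun _ => false)
    (fun _ => false) (O.receiver n).init (O.rounds n + 2)).map
      fun z => z.1 (chshVerifier (O.rounds n) (O.sender n)).out) true
  rw [h, prob_coin_bind]
  -- The factor `2` on the error is cancelled by the average over the uniform `r`.
  have h2 : ∀ r : Bool, Real.cos (Real.pi / 8) ^ 2 - 2 * (1 - expect (O.interaction n r
        (O.receiver n).toQuantumParty) fun z => OSPProtocol.ospNorm r (z.1 (O.sender n).out)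
          (O.receiver n).outQubit z.2.2.2.1)
      ≤ prob ((interact (O.sender n).liftAct
          (fun i => circActQ (proverTurn (O.rounds n) (O.receiver n) i)) ((O.sender n).init r)
          (fun _ => false) (O.receiver n).init (O.rounds n)).bind fun s =>
            (PMF.uniformOfFintype Bool).bind fun a =>
              (circActQ (proverTurn (O.rounds n) (O.receiver n) (O.rounds n))
                (s.2.2, Function.update s.2.1 (.inr ()) a)).map fun t =>
                ((r && a) ^^ s.1 (O.sender n).out) == t.2 (.inr ())) true := by
    intro r
    rw [interact_proverTurn, PMF.bind_map, prob_bind]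
    have hb : ∀ z : (((O.sender n).Mem → Bool) × (O.Comm n → Bool) × (O.receiver n).State),
        |2 * OSPProtocol.ospNorm r (z.1 (O.sender n).out) (O.receiver n).outQubit z.2.2.2.1| ≤ 2 :=
      fun z => by
        rw [abs_of_nonneg (mul_nonneg zero_le_two (ospNorm_nonneg _ _ _ _))]
        linarith [ospNorm_le_one r (z.1 (O.sender n).out) (O.receiver n).outQubit z.2.2.2]
    have ha := expect_add (O.interaction n r (O.receiver n).toQuantumParty)
      (fun _ => le_refl |Real.cos (Real.pi / 8) ^ 2 - 2|) hb
    rw [expect_const, expect_const_mul] at ha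
    rw [mul_sub, mul_one, ← sub_add, ← ha]
    refine expect_mono _ (fun z => (abs_add_le _ _).trans (add_le_add le_rfl (hb z)))
      (fun z => abs_prob_le_one _ _) fun z => ?_
    have := prob_chsh_answer (O.rounds n) (O.receiver n) r (z.1 (O.sender n).out) z.2.2.1 z.2.2.2
      (Sum.elim z.2.1 fun _ => false)
    rw [mul_sub, mul_one, ← sub_add] at this
    exact this
  have h3 := h2 false
  have h4 := h2 true
  rw [Fintype.sum_bool]
  linarith

/-! ## Rewinding a classical circuit -/

section Rewind

variable {W W' : Type} [DecidableEq W] [DecidableEq W'] {e₀ e₁ : W → W'}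

/-- Classical contents can be cloned; this is the step of the rewinding argument that an unknown
quantum state would not allow. As the ranges are disjoint, a copy gate never alters a wire still to
be read. -/
theorem runC_copies (h₁ : e₁.Injective) (h : ∀ i j, e₀ i ≠ e₁ j) (l : List W) (v : W' → Bool) :
    ∃ v' : W' → Bool, runC (l.map fun w => CGate.copy (e₀ w) (e₁ w)) v = PMF.pure v' ∧
      v' ∘ e₀ = v ∘ e₀ ∧ ∀ w, v' (e₁ w) = if w ∈ l then v (e₀ w) else v (e₁ w) := by
  induction l generalizing v with
  | nil => exact ⟨v, rfl, rfl, fun w => by simp⟩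
  | cons a l ih =>
    obtain ⟨v', h1, h2, h3⟩ := ih (Function.update v (e₁ a) (v (e₀ a)))
    have h4 : Function.update v (e₁ a) (v (e₀ a)) ∘ e₀ = v ∘ e₀ := by
      funext w
      exact Function.update_of_ne (h w a) _ _
    refine ⟨v', ?_, h2.trans h4, fun w => ?_⟩
    · rw [List.map_cons, runC_cons, run_copy, PMF.pure_bind, h1]
    · rw [h3, show Function.update v (e₁ a) (v (e₀ a)) (e₀ w) = v (e₀ w) from congrFun h4 w]
      by_cases hw : w ∈ l
      · simp [hw]
      · by_cases hwa : w = a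
        · subst hwa; simp
        · simp [hw, hwa, h₁.ne hwa]

/-- Copy the wires `e₀` to the wires `e₁`, run `gs` on the two copies with the bit `u` set to `0`
in the first and to `1` in the second, and add up the two resulting values of `u`. -/
noncomputable def rewindCircuit [Fintype W] (e₀ e₁ : W → W') (u : W) (gs : List (CGate W)) :
    List (CGate W') :=
  ((Finset.univ : Finset W).toList.map fun w => CGate.copy (e₀ w) (e₁ w)) ++
    ([CGate.app (fun _ _ => false) (e₀ u) (e₀ u) (e₀ u),
      CGate.app (fun _ _ => true) (e₁ u) (e₁ u) (e₁ u)] ++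
    (gs.map (CGate.map e₀) ++ (gs.map (CGate.map e₁) ++
      [CGate.app Bool.xor (e₀ u) (e₁ u) (e₀ u)])))

end Rewind

/-- The sum of the values of the wire `u` in two runs of a circuit, in which its initial value
is `0` and `1`. -/
noncomputable def xorRuns {W : Type} [DecidableEq W] (u : W) (gs : List (CGate W)) (v : W → Bool) :
    PMF Bool :=
  ((runC gs (Function.update v u false)).map fun y => y u).bind fun b₀ =>
    ((runC gs (Function.update v u true)).map fun y => y u).map fun b₁ => b₀ ^^ b₁

theorem length_rewindCircuit {W W' : Type} [Fintype W] (e₀ e₁ : W → W') (u : W)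
    (gs : List (CGate W)) :
    (rewindCircuit e₀ e₁ u gs).length = Fintype.card W + 2 * gs.length + 3 := by
  simp [rewindCircuit]
  ring

/-- Disjoint ranges make each run invisible to the other copy. Both runs therefore start from the
same contents apart from `u`, and use independent coins, which is the product structure in
`xorRuns`. -/
theorem runC_rewindCircuit {W W' : Type} [DecidableEq W] [DecidableEq W'] [Fintype W]
    {e₀ e₁ : W → W'} (h₀ : e₀.Injective) (h₁ : e₁.Injective)
    (h : ∀ i j, e₀ i ≠ e₁ j) (u : W) (gs : List (CGate W)) (v : W' → Bool) :
    (runC (rewindCircuit e₀ e₁ u gs) v).map (fun w => w (e₀ u)) = xorRuns u gs (v ∘ e₀) := by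
  obtain ⟨v', hv, hv0, hv1⟩ := runC_copies h₁ h Finset.univ.toList v
  have hv1' : v' ∘ e₁ = v ∘ e₀ := by
    funext w
    simpa using hv1 w
  have hc0 : ∀ (w : W' → Bool) b, Function.update w (e₀ u) b ∘ e₀
      = Function.update (w ∘ e₀) u b := fun w b => Function.update_comp_eq_of_injective _ h₀ _ _
  have hc1 : ∀ (w : W' → Bool) b, Function.update w (e₁ u) b ∘ e₁
      = Function.update (w ∘ e₁) u b := fun w b => Function.update_comp_eq_of_injective _ h₁ _ _
  have hd0 : ∀ (w : W' → Bool) b, Function.update w (e₁ u) b ∘ e₀ = w ∘ e₀ :=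
    fun w b => funext fun i => Function.update_of_ne (h i u) _ _
  have hd1 : ∀ (w : W' → Bool) b, Function.update w (e₀ u) b ∘ e₁ = w ∘ e₁ :=
    fun w b => funext fun i => Function.update_of_ne (h u i).symm _ _
  have he0 : ∀ (y : W → Bool) (w : W' → Bool) i, Function.extend e₀ y w (e₀ i) = y i :=
    fun y w i => h₀.extend_apply _ _ _
  have he1 : ∀ (y : W → Bool) (w : W' → Bool) i, Function.extend e₁ y w (e₁ i) = y i :=
    fun y w i => h₁.extend_apply _ _ _
  have hx0 : ∀ (y : W → Bool) (w : W' → Bool) i, Function.extend e₁ y w (e₀ i) = w (e₀ i) :=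
    fun y w i => Function.extend_apply' _ _ _ fun ⟨j, hj⟩ => h i j hj.symm
  have hx1 : ∀ (y : W → Bool) (w : W' → Bool), Function.extend e₀ y w ∘ e₁ = w ∘ e₁ :=
    fun y w => funext fun i => Function.extend_apply' _ _ _ fun ⟨j, hj⟩ => h j i hj
  rw [rewindCircuit, runC_append, hv, PMF.pure_bind, runC_append, runC_cons, run_app,
    PMF.pure_bind, runC_cons, run_app, PMF.pure_bind, runC_nil, PMF.pure_bind, runC_append,
    runC_map h₀, hd0, hc0, hv0, PMF.bind_map, PMF.map_bind, xorRuns, PMF.bind_map]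
  congr 1
  funext y
  simp only [Function.comp_apply]
  rw [runC_append, runC_map h₁, hx1, hc1, hd1, hv1', PMF.bind_map, PMF.map_bind]
  simp only [Function.comp_def, runC_cons, runC_nil, run_app, PMF.pure_bind, PMF.pure_map,
    Function.update_self, hx0, he0, he1]
  rw [PMF.map_comp]
  exact PMF.bind_pure_comp _ _

/-- A union bound: if the two bits equal `s` and `r ⊕ s`, their sum is `r`. -/
theorem le_prob_xor (p₀ p₁ : PMF Bool) (r s : Bool) :
    prob p₀ s + prob p₁ (r ^^ s) - 1 ≤ prob (p₀.bind fun b₀ => p₁.map fun b₁ => b₀ ^^ b₁) r := by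
  have h : ∀ b₀, prob (p₁.map fun b₁ => b₀ ^^ b₁) r = prob p₁ (r ^^ b₀) := by
    intro b₀
    conv_rhs => rw [← PMF.map_id p₁]
    refine prob_map_congr _ fun x => ?_
    cases b₀ <;> cases r <;> cases x <;> simp
  rw [prob_bind, expect_bool, h, h]
  have h0 := prob_true_add_false p₀
  have h1 := prob_true_add_false p₁
  have a0 := prob_nonneg p₀ true
  have a1 := prob_nonneg p₀ false
  have b0 := prob_nonneg p₁ true
  have b1 := prob_nonneg p₁ false
  have e0 : prob p₀ false = 1 - prob p₀ true := by linarith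
  have e1 : prob p₁ false = 1 - prob p₁ true := by linarith
  -- With `x = prob p₀ s` and `y = prob p₁ (r ^^ s)`, the difference of the two sides is `2 (1 - x)
  -- (1 - y)`.
  cases r <;> cases s <;>
    simp only [Bool.xor_false, Bool.xor_true, Bool.not_true, Bool.not_false, e0, e1] at * <;>
    nlinarith [mul_nonneg a0 b0, mul_nonneg a1 b1, mul_nonneg a0 b1, mul_nonneg a1 b0]

/-! ## Soundness -/

section Soundness

variable {C : Type}

/-- The wires of a classical prover of the CHSH test, among those of the distinguisher that
simulates it. -/
def simWire {M C : Type} : M ⊕ (C ⊕ Unit) → ((M ⊕ Unit) ⊕ (M ⊕ (C ⊕ Unit))) ⊕ C :=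
  Sum.elim (fun x => .inl (.inl (.inl x))) (Sum.elim .inr fun u => .inl (.inl (.inr u)))

/-- The wires of a second copy of the prover. -/
def copyWire {M C : Type} : M ⊕ (C ⊕ Unit) → ((M ⊕ Unit) ⊕ (M ⊕ (C ⊕ Unit))) ⊕ C :=
  fun x => .inl (.inr x)

theorem simWire_injective {M C : Type} : (simWire (M := M) (C := C)).Injective := by
  rintro (x | x | x) (y | y | y) h <;> simp_all [simWire]

theorem copyWire_injective {M C : Type} : (copyWire (M := M) (C := C)).Injective := by
  intro x y h
  simpa [copyWire] using h

theorem simWire_ne_copyWire {M C : Type} (x y : M ⊕ (C ⊕ Unit)) : simWire x ≠ copyWire y := by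
  rcases x with x | x | x <;> simp [simWire, copyWire]

variable [DecidableEq C]

/-- The state of the CHSH test that is simulated in the interaction of the sender with the
distinguisher. -/
def simState {α M : Type}
    (z : α × (C → Bool) × (((M ⊕ Unit) ⊕ (M ⊕ (C ⊕ Unit)) → Bool) × QState Empty)) :
    α × (C ⊕ Unit → Bool) × (M → Bool) :=
  (z.1, Sum.elim z.2.1 (fun _ => z.2.2.1 (.inl (.inr ()))), fun a => z.2.2.1 (.inl (.inl a)))

/-- The OSP has no wire for the extra message bit, so the simulation keeps it in private memory. The
two interactions agree because `S.liftAct` leaves that bit alone. -/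
theorem interact_sim (k : ℕ) (S : Sender C) (A : ClassicalParty (C ⊕ Unit)) (m : S.Mem → Bool) :
    interact S.liftAct A.act m (fun _ => false) (fun _ => false) k
      = (interact S.act
          (fun i => circActQ (((A.turn i).map (CGate.map simWire)).map QGate.classical)) m
          (fun _ => false) (fun _ => false, zeroState) k).map simState := by
  refine interact_map _ _ _ _ _ _ _ ?_ k ?_ ?_
  · refine Prod.ext rfl (Prod.ext ?_ rfl)
    funext x
    rcases x with x | x <;> rfl
  · intro i _ s
    rw [moveA, moveA, Sender.liftAct, PMF.map_comp, PMF.map_comp]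
    rfl
  · rintro i _ ⟨m, c, w, ψ⟩
    have hw : (Sum.elim w c : ((A.Mem ⊕ Unit) ⊕ (A.Mem ⊕ (C ⊕ Unit))) ⊕ C → Bool) ∘ simWire
        = Sum.elim (fun a => w (.inl (.inl a))) (Sum.elim c fun _ => w (.inl (.inr ()))) := by
      funext x
      rcases x with x | x | x <;> rfl
    rw [moveB, moveB, circActQ_classical, circAct, runC_map simWire_injective, hw,
      ClassicalParty.act_eq, circAct]
    simp only [PMF.map_comp]
    unfold simState
    dsimp only
    congr 1
    funext v
    have he (x) : Function.extend simWire v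
        (Sum.elim w c : ((A.Mem ⊕ Unit) ⊕ (A.Mem ⊕ (C ⊕ Unit))) ⊕ C → Bool) (simWire x)
        = v x := simWire_injective.extend_apply _ _ _
    refine Prod.ext rfl (Prod.ext ?_ ?_) <;> funext x
    · rcases x with x | x
      · exact (he (.inr (.inl x))).symm
      · exact (he (.inr (.inr ()))).symm
    · exact (he (.inl x)).symm

/-- The distribution of the sum of the prover's answers to both challenges. -/
noncomputable def answerSum {α : Type} (k : ℕ) (A : ClassicalParty (C ⊕ Unit))
    (s : α × (C ⊕ Unit → Bool) × (A.Mem → Bool)) : PMF Bool :=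
  xorRuns (.inr (.inr ())) (A.turn k) (Sum.elim s.2.2 s.2.1)

/-- From the sender's input and output bits, the sum of the answers to both challenges is at least
as predictable as correct answers. -/
theorem two_mul_accept_le (k : ℕ) (A : ClassicalParty (C ⊕ Unit)) {α : Type} (r s : Bool)
    (z : α × (C ⊕ Unit → Bool) × (A.Mem → Bool)) :
    2 * prob ((PMF.uniformOfFintype Bool).bind fun a =>
        (A.act k (z.2.2, Function.update z.2.1 (.inr ()) a)).map fun t =>
          ((r && a) ^^ s) == t.2 (.inr ())) true - 1
      ≤ prob (answerSum k A z) r := by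
  have h : ∀ a, prob ((A.act k (z.2.2, Function.update z.2.1 (.inr ()) a)).map
      fun t => ((r && a) ^^ s) == t.2 (.inr ())) true
      = prob ((runC (A.turn k) (Function.update (Sum.elim z.2.2 z.2.1) (.inr (.inr ())) a)).map
          fun y => y (.inr (.inr ()))) ((r && a) ^^ s) := by
    intro a
    rw [ClassicalParty.act_eq, circAct, PMF.map_comp]
    dsimp only
    rw [← Sum.update_elim_inr]
    refine prob_map_congr _ fun x => ?_
    simp only [Function.comp_apply, beq_iff_eq]
    exact eq_comm
  have h2 := le_prob_xor
    ((runC (A.turn k) (Function.update (Sum.elim z.2.2 z.2.1) (.inr (.inr ())) false)).map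
      fun y => y (.inr (.inr ())))
    ((runC (A.turn k) (Function.update (Sum.elim z.2.2 z.2.1) (.inr (.inr ())) true)).map
      fun y => y (.inr (.inr ()))) r s
  -- The correct answers to the challenges `0` and `1` are `s` and `r ^^ s`.
  rw [prob_coin_bind, h, h, Bool.and_false, Bool.and_true, Bool.false_xor]
  refine le_trans (le_of_eq ?_) h2
  ring

variable [Fintype C]

/-- The turns of the distinguisher that simulates a classical prover: after the `k` rounds of the
OSP it computes the prover's answers to both challenges. -/
noncomputable def simTurn (k : ℕ) (A : ClassicalParty (C ⊕ Unit)) (i : ℕ) :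
    List (CGate (((A.Mem ⊕ Unit) ⊕ (A.Mem ⊕ (C ⊕ Unit))) ⊕ C)) :=
  (A.turn i).map (CGate.map simWire) ++
    if i + 1 = k then rewindCircuit simWire copyWire (.inr (.inr ())) (A.turn k) else []

/-- The distinguisher that outputs the sum of a classical prover's answers to both challenges. -/
noncomputable def simDistinguisher (k : ℕ) (A : ClassicalParty (C ⊕ Unit)) : Distinguisher C where
  Mem := (A.Mem ⊕ Unit) ⊕ (A.Mem ⊕ (C ⊕ Unit))
  Qub := Empty
  turn i := (simTurn k A i).map QGate.classical
  out := .inl (.inr ())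

/-- The answering turn of the prover has index `k + 1`, but the OSP ends after round `k`, so the
distinguisher appends both runs of that turn to its last move. Nothing is lost: before the prover
answers, the verifier changes only the challenge bit of the message register, and the rewinding
circuit overwrites it. At least one round is needed to have a last move. -/
theorem simDistinguisher_out (k : ℕ) (S : Sender C) (A : ClassicalParty (C ⊕ Unit))
    (m : S.Mem → Bool) :
    (interact S.act (simDistinguisher (k + 1) A).act m (fun _ => false)
        (simDistinguisher (k + 1) A).init (k + 1)).map
        (fun z => z.2.2.1 (simDistinguisher (k + 1) A).out)
      = (interact S.liftAct A.act m (fun _ => false) (fun _ => false) (k + 1)).bind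
          (answerSum (k + 1) A) := by
  change (interact S.act (fun i => circActQ ((simTurn (k + 1) A i).map QGate.classical)) m
    (fun _ => false) (fun _ => false, zeroState) (k + 1)).map (fun z => z.2.2.1 (.inl (.inr ()))) = _
  -- In all rounds but the last, the distinguisher runs the prover's circuit alone.
  rw [interact_sim, PMF.bind_map, interact_succ, interact_succ, interact_congr (actA' := S.act)
    (actB' := fun i => circActQ (((A.turn i).map (CGate.map simWire)).map QGate.classical))
    _ _ _ k (fun _ _ => rfl) (fun i hi => by
      have h : i + 1 ≠ k + 1 := by omega
      simp only [simTurn, if_neg h, List.append_nil]), PMF.map_bind]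
  simp only [PMF.bind_bind]
  congr 1
  funext s₀
  congr 1
  funext s
  have h : simTurn (k + 1) A k = (A.turn k).map (CGate.map simWire)
      ++ rewindCircuit simWire copyWire (.inr (.inr ())) (A.turn (k + 1)) := by
    simp [simTurn]
  unfold moveB
  dsimp only
  rw [h, List.map_append, circActQ_append, PMF.map_comp, PMF.map_bind, PMF.bind_map]
  congr 1
  funext t
  rw [circActQ_classical, PMF.map_comp, circAct, PMF.map_comp]
  refine (runC_rewindCircuit simWire_injective copyWire_injective simWire_ne_copyWire
    (.inr (.inr ())) _ _).trans ?_
  unfold answerSum simState Function.comp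
  congr 1
  funext x
  rcases x with x | x | x <;> rfl

end Soundness

/-- The acceptance probability of a classical prover exceeds `3/4` by at most a quarter of the
advantage of a distinguisher against the OSP. -/
theorem chshTest_classicalAccept (O : OSPProtocol) (n : ℕ) (A : ClassicalParty (O.Comm n ⊕ Unit)) :
    (chshTest O).classicalAccept n A ≤ 3 / 4 + 1 / 4 *
      |prob (O.guess n false (simDistinguisher (O.rounds n) A)) false
        - prob (O.guess n true (simDistinguisher (O.rounds n) A)) false| := by
  set J : Bool → PMF (((O.sender n).Mem → Bool) × (O.Comm n ⊕ Unit → Bool) × (A.Mem → Bool)) :=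
    fun r => interact (O.sender n).liftAct A.act ((O.sender n).init r) (fun _ => false)
      (fun _ => false) (O.rounds n) with hJ
  set G : Bool → PMF Bool := fun r => (J r).bind (answerSum (O.rounds n) A) with hG
  have h1 : |prob (G false) false - prob (G true) false|
      ≤ |prob (O.guess n false (simDistinguisher (O.rounds n) A)) false
        - prob (O.guess n true (simDistinguisher (O.rounds n) A)) false| := by
    rcases hk : O.rounds n with _ | k
    -- An OSP without rounds gives the distinguisher no turn. But then the prover has seen nothing
    -- depending on `r`, and `answerSum` ignores the sender's memory, so the advantage of `G` is
    -- zero.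
    · have h0 : G false = G true := by
        simp only [hG, hJ, hk]
        change (PMF.pure _).bind _ = (PMF.pure _).bind _
        rw [PMF.pure_bind, PMF.pure_bind]
        rfl
      rw [h0, sub_self, abs_zero]
      exact abs_nonneg _
    · have h2 : ∀ r, O.guess n r (simDistinguisher (k + 1) A) = G r := by
        intro r
        simp only [hG, hJ, hk]
        rw [← simDistinguisher_out]
        unfold OSPProtocol.guess OSPProtocol.interaction
        rw [hk]
      rw [h2, h2]
  have h2 := chshVerifier_verdict (O.rounds n) (O.sender n) A.act (fun _ => false)
  have h3 : (chshTest O).classicalAccept n A = _ := congrArg (fun p => prob p true) h2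
  rw [h3, prob_coin_bind]
  have h4 : ∀ r, 2 * prob ((J r).bind fun s =>
        (PMF.uniformOfFintype Bool).bind fun a =>
          (A.act (O.rounds n) (s.2.2, Function.update s.2.1 (.inr ()) a)).map fun t =>
            ((r && a) ^^ s.1 (O.sender n).out) == t.2 (.inr ())) true - 1
      ≤ prob (G r) r := by
    intro r
    have ha := expect_add (J r) (f := fun s => 2 * prob ((PMF.uniformOfFintype Bool).bind fun a =>
          (A.act (O.rounds n) (s.2.2, Function.update s.2.1 (.inr ()) a)).map fun t =>
            ((r && a) ^^ s.1 (O.sender n).out) == t.2 (.inr ())) true) (g := fun _ => -1)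
      (C := 2) (D := |-1|) (fun s => by
        rw [abs_mul, abs_two]
        linarith [abs_prob_le_one ((PMF.uniformOfFintype Bool).bind fun a =>
          (A.act (O.rounds n) (s.2.2, Function.update s.2.1 (.inr ()) a)).map fun t =>
            ((r && a) ^^ s.1 (O.sender n).out) == t.2 (.inr ())) true]) fun _ => le_rfl
    rw [expect_const, expect_const_mul] at ha
    rw [hG, prob_bind, prob_bind, sub_eq_add_neg, ← ha]
    refine expect_mono _ (C := 3) (fun s => ?_) (fun s => abs_prob_le_one _ _) fun s => ?_
    · refine (abs_add_le _ _).trans ?_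
      rw [abs_mul, abs_two, abs_neg, abs_one]
      linarith [abs_prob_le_one ((PMF.uniformOfFintype Bool).bind fun a =>
          (A.act (O.rounds n) (s.2.2, Function.update s.2.1 (.inr ()) a)).map fun t =>
            ((r && a) ^^ s.1 (O.sender n).out) == t.2 (.inr ())) true]
    · have := two_mul_accept_le (O.rounds n) A r (s.1 (O.sender n).out) s
      rw [sub_eq_add_neg] at this
      exact this
  have h5 := h4 false
  have h6 := h4 true
  have h7 := prob_true_add_false (G true)
  have h8 := le_abs_self (prob (G false) false - prob (G true) false)
  simp only [hJ] at h5 h6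
  -- Adding `h5` and `h6`, with `prob (G true) true = 1 - prob (G true) false`, bounds twice the sum
  -- of the two acceptance probabilities by `3` plus the advantage; the average over `r` is a
  -- quarter of that.
  linarith

/-! ## Efficiency -/

theorem PolyBounded.of_le {f g : ℕ → ℕ} (hf : PolyBounded f) (a b : ℕ)
    (h : ∀ n, g n ≤ a * f n + b) : PolyBounded g := by
  obtain ⟨c, N, hN⟩ := hf
  -- One more power of `n` absorbs the constants as soon as `n > a + b`.
  refine ⟨c + 1, N + a + b, fun n hn => ?_⟩
  have h1 : 0 < n ^ c := pow_pos (by omega) _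
  have h2 : a * f n ≤ a * n ^ c := Nat.mul_le_mul_left _ (hN n (by omega)).le
  have h3 : b ≤ b * n ^ c := Nat.le_mul_of_pos_right _ h1
  have h4 : (a + b) * n ^ c < n * n ^ c := Nat.mul_lt_mul_of_pos_right (by omega) h1
  have h5 := h n
  rw [pow_succ']
  linarith

theorem PolyBounded.add {f g : ℕ → ℕ} (hf : PolyBounded f) (hg : PolyBounded g) :
    PolyBounded fun n => f n + g n := by
  obtain ⟨c, N, hN⟩ := hf
  obtain ⟨d, M, hM⟩ := hg
  refine ⟨c + d + 1, N + M + 2, fun n hn => ?_⟩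
  have h1 : n ^ c ≤ n ^ (c + d) := Nat.pow_le_pow_right (by omega) (by omega)
  have h2 : n ^ d ≤ n ^ (c + d) := Nat.pow_le_pow_right (by omega) (by omega)
  have h3 : 2 * n ^ (c + d) ≤ n * n ^ (c + d) := Nat.mul_le_mul_right _ (by omega)
  have := hN n (by omega)
  have := hM n (by omega)
  rw [pow_succ']
  linarith

section Sizes

variable {C : Type}

/-- The `10` consists of three bits, two gates for `r`, two for the challenge and three for the
verdict. -/
theorem chshVerifier_size_le (k : ℕ) (S : Sender C) :
    (chshVerifier k S).size (k + 2) ≤ S.size k + 10 := by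
  have hc : Fintype.card (S.Mem ⊕ CHSHBit) = Fintype.card S.Mem + 3 := by
    rw [Fintype.card_sum]; rfl
  have h : ∀ i ∈ Finset.range k, ((chshVerifier k S).turn i).length
      = (if i = 0 then 2 else 0) + (S.turn i).length := by
    intro i hi
    have hi' := Finset.mem_range.1 hi
    by_cases h0 : i = 0
    · subst h0
      simp [chshVerifier, hi']
      omega
    · simp [chshVerifier, hi', h0]
  have h0 : ∑ i ∈ Finset.range k, (if i = 0 then 2 else 0) ≤ 2 := by
    rw [Finset.sum_ite_eq']
    split_ifs <;> simp
  -- For `k = 0` the choice of `r` falls into the challenge turn.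
  have h1 : ((chshVerifier k S).turn k).length ≤ (if k = 0 then 2 else 0) + 2 := by
    by_cases h0 : k = 0 <;> simp [chshVerifier, h0]
  have h2 : ((chshVerifier k S).turn (k + 1)).length ≤ 3 := by
    simp [chshVerifier]
  unfold ClassicalParty.size
  rw [Finset.sum_range_succ, Finset.sum_range_succ, Finset.sum_congr rfl h, Finset.sum_add_distrib]
  have hc' : Fintype.card (chshVerifier k S).Mem = Fintype.card S.Mem + 3 := hc
  rw [hc']
  by_cases hk : k = 0
  · subst hk
    simp at h1 h2 ⊢
    omega
  · rw [if_neg hk] at h1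
    omega

theorem chshProver_size_le (k : ℕ) (R : Receiver C) :
    (chshProver k R).size (k + 2) ≤ R.size k + 9 := by
  have h : ∀ i ∈ Finset.range k, ((chshProver k R).turn i).length = (R.turn i).length := by
    intro i hi
    simp [chshProver, Finset.mem_range.1 hi]
  have h1 : ((chshProver k R).turn k).length = 9 := by simp [chshProver, measureCHSH]
  have h2 : ((chshProver k R).turn (k + 1)).length = 0 := by simp [chshProver]
  unfold QuantumParty.size
  rw [Finset.sum_range_succ, Finset.sum_range_succ, Finset.sum_congr rfl h, h1, h2]
  change Fintype.card R.Mem + Fintype.card R.Qub + _ ≤ _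
  omega

/-- The prover's memory is counted three times: for itself, for its copy and for the copying gates.
The answering turn `k` is run twice, and is included in the prover's size over the test's `k + 2`
rounds. -/
theorem simDistinguisher_size_le [Fintype C] [DecidableEq C] (k : ℕ)
    (A : ClassicalParty (C ⊕ Unit)) :
    (simDistinguisher k A).size k ≤ 3 * A.size (k + 2) + (2 * Fintype.card C + 6) := by
  have h : ∀ i ∈ Finset.range k, ((simDistinguisher k A).turn i).length
      = (A.turn i).length + if i + 1 = k then
        (rewindCircuit (simWire (M := A.Mem) (C := C)) copyWire (.inr (.inr ()))
          (A.turn k)).length else 0 := by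
    intro i _
    by_cases h0 : i + 1 = k <;> simp [simDistinguisher, simTurn, h0]
  have h0 : ∀ L : ℕ, ∑ i ∈ Finset.range k, (if i + 1 = k then L else 0) ≤ L := by
    intro L
    rcases k with _ | k
    · simp
    · simp only [Nat.add_right_cancel_iff]
      rw [Finset.sum_ite_eq']
      split_ifs <;> simp
  have hm : Fintype.card (simDistinguisher k A).Mem
      = 2 * Fintype.card A.Mem + Fintype.card C + 2 := by
    change Fintype.card ((A.Mem ⊕ Unit) ⊕ (A.Mem ⊕ (C ⊕ Unit))) = _
    simp only [Fintype.card_sum, Fintype.card_unit]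
    ring
  have hq : Fintype.card (simDistinguisher k A).Qub = 0 := Fintype.card_eq_zero (α := Empty)
  have hr := length_rewindCircuit (simWire (M := A.Mem) (C := C)) copyWire (.inr (.inr ()))
    (A.turn k)
  simp only [Fintype.card_sum, Fintype.card_unit] at hr
  unfold QuantumParty.size ClassicalParty.size
  rw [Finset.sum_congr rfl h, Finset.sum_add_distrib, Finset.sum_range_succ, Finset.sum_range_succ,
    hm, hq]
  have := h0 (rewindCircuit (simWire (M := A.Mem) (C := C)) copyWire (.inr (.inr ()))
          (A.turn k)).length
  omega

end Sizes

theorem chshTest_efficient {O : OSPProtocol} (hO : O.Efficient) : (chshTest O).Efficient := by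
  obtain ⟨h1, h2, h3⟩ := hO
  refine ⟨h1.of_le 1 3 fun n => ?_, h2.of_le 1 10 fun n => ?_, h3.of_le 1 9 fun n => ?_⟩
  · have : Fintype.card (O.Comm n ⊕ Unit) = Fintype.card (O.Comm n) + 1 := by simp
    change Fintype.card (O.Comm n ⊕ Unit) + (O.rounds n + 2) ≤ _
    omega
  · rw [one_mul]
    exact chshVerifier_size_le _ _
  · rw [one_mul]
    exact chshProver_size_le _ _

theorem chshTest_sound {O : OSPProtocol} (hO : O.IsOSP) : (chshTest O).Sound fun _ => 3 / 4 := by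
  intro A hA
  refine ⟨_, (hO.2.2 (fun n => simDistinguisher (O.rounds n) (A n)) ?_).const_mul (1 / 4),
    fun n => chshTest_classicalAccept O n (A n)⟩
  refine (hA.add hO.1.1).of_le 3 6 fun n => (simDistinguisher_size_le _ _).trans ?_
  change 3 * (A n).size (O.rounds n + 2) + _
    ≤ 3 * ((A n).size (O.rounds n + 2) + (Fintype.card (O.Comm n) + O.rounds n)) + 6
  omega

end OSPQuantum

/-! ### The main theorem -/

theorem mainTheorem3 (O : OSPProtocol) (hO : O.IsOSP) :
    (chshTest O).IsProofOfQuantumness ∧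
    ∃ ν : ℕ → ℝ, Negligible ν ∧
      (∀ᶠ n in atTop, 0.85 < Real.cos (Real.pi / 8) ^ 2 - ν n) ∧
      (chshTest O).IsProofOfQuantumnessWith
        (fun n => Real.cos (Real.pi / 8) ^ 2 - ν n) (fun _ => 3 / 4) := by
  suffices h : ∃ ν : ℕ → ℝ, Negligible ν ∧
      (∀ᶠ n in atTop, 0.85 < Real.cos (Real.pi / 8) ^ 2 - ν n) ∧
      (chshTest O).IsProofOfQuantumnessWith
        (fun n => Real.cos (Real.pi / 8) ^ 2 - ν n) (fun _ => 3 / 4) by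
    obtain ⟨ν, hν⟩ := h
    exact ⟨⟨_, _, hν.2.2⟩, ν, hν⟩
  refine ⟨fun n => ∑ r : Bool, (1 - expect (O.interaction n r
        (O.receiver n).toQuantumParty) fun z => OSPProtocol.ospNorm r (z.1 (O.sender n).out)
          (O.receiver n).outQubit z.2.2.2.1), ?_⟩
  have hneg : Negligible fun n => ∑ r : Bool, (1 - expect (O.interaction n r
        (O.receiver n).toQuantumParty) fun z => OSPProtocol.ospNorm r (z.1 (O.sender n).out)
          (O.receiver n).outQubit z.2.2.2.1) := by
    simp only [Fintype.sum_bool]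
    exact (hO.2.1 true).add (hO.2.1 false)
  have hcos : 0.853 < Real.cos (Real.pi / 8) ^ 2 := by
    have h : (0.707 : ℝ) < 1 / √2 := by
      have h1 := inv_sqrt_two_sq
      have h2 : 0 < 1 / √2 := by positivity
      nlinarith
    rw [cos_sq_pi_div_eight]
    norm_num at h ⊢
    linarith
  -- Exponent `0` in negligibility is plain convergence to zero; `0.003` is the slack between
  -- `0.853` and `0.85`.
  have hlarge := (hneg 0).eventually (gt_mem_nhds (show (0 : ℝ) < 0.003 by norm_num))
  have hlarge' : ∀ᶠ n in atTop, 0.85 < Real.cos (Real.pi / 8) ^ 2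
      - ∑ r : Bool, (1 - expect (O.interaction n r
        (O.receiver n).toQuantumParty) fun z => OSPProtocol.ospNorm r (z.1 (O.sender n).out)
          (O.receiver n).outQubit z.2.2.2.1) := by
    filter_upwards [hlarge] with n hn
    rw [pow_zero, one_mul] at hn
    norm_num at hn hcos ⊢
    linarith
  refine ⟨hneg, hlarge', chshTest_efficient hO.1, ?_, chshTest_honestAccept O, chshTest_sound hO⟩
  obtain ⟨N, hN⟩ := eventually_atTop.1 hlarge'
  -- The gap eventually exceeds `0.85 - 0.75 = 1/10`, hence `1/n` once `n ≥ 10`.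
  refine ⟨1, N + 10, fun n hn => ?_⟩
  have h1 := hN n (by omega)
  have h2 : (10 : ℝ) ≤ n := by exact_mod_cast (by omega : 10 ≤ n)
  have h3 : 1 / (n : ℝ) ^ 1 ≤ 1 / 10 := by
    rw [pow_one]
    exact one_div_le_one_div_of_le (by norm_num) h2
  norm_num at h1 h3 ⊢
  linarith
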